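/- Let $X$ be a nonsingular projective connected curve over a finite field $\mathbb{F}_q$, with function field $K$, and let $D$ be a finite subscheme of $X$, corresponding to the effective divisor $[D]=\sum_i n_i x_i$, where the $x_i$ are distinct closed points of $X$ and $n_i\ge 0$. For a place $v$ of $K$ let $K_v$ be the completion of $K$ at $v$, let $\mathcal{O}_v$ be its ring of integers with maximal ideal $\mathfrak{m}_v$, and let $\mathbb{A}_K=\prod_v' K_v$ be the adele ring of $K$, the restricted product over all places $v$ of $K$ with respect to the rings $\mathcal{O}_v$. Let $v_i$ be the place of $K$ given by $x_i$ and let $$\mathbb{O}_D^\times=\{(a_v)_v\in\prod_v\mathcal{O}_v^\times : a_{v_i}\equiv 1 \bmod \mathfrak{m}_{v_i}^{n_i}\text{ for all } i\}\subseteq\mathbb{A}_K^\times .$$ Let $Pic_D(\mathbb{F}_q)$ be the set of equivalence classes of pairs $(\mathcal{L},\psi)$, where $\mathcal{L}$ is a line bundle on $X$ and $\psi:\mathcal{L}|_D\to\mathcal{O}|_D$ is a trivialization over $D$, i.e. a family of isomorphisms of $\mathcal{O}_{X,x_i}$-modules $\psi_i:\mathcal{L}_{x_i}/\mathfrak{m}_{x_i}^{n_i}\mathcal{L}_{x_i}\to\mathcal{O}_{X,x_i}/\mathfrak{m}_{x_i}^{n_i}$.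 Two pairs $(\mathcal{L},\psi)$ and $(\mathcal{L}',\psi')$ are equivalent if there is an isomorphism $\theta:\mathcal{L}\to\mathcal{L}'$ with $\psi'\circ\theta|_D=\psi$. The operation $(\mathcal{L},\psi)\otimes(\mathcal{L}',\psi')=(\mathcal{L}\otimes\mathcal{L}',\psi'')$, where $\psi''(s\otimes s')=\psi(s)\psi'(s')$, makes $Pic_D(\mathbb{F}_q)$ into an abelian group, and there exists an isomorphism of groups $$K^\times\backslash\mathbb{A}_K^\times/\mathbb{O}_D^\times\;\cong\;Pic_D(\mathbb{F}_q).$$ -/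

import Mathlib

open CategoryTheory AlgebraicGeometry TopologicalSpace
open scoped RestrictedProduct

universe u

noncomputable section

namespace GenPic

section Adeles

/-! Places, adeles and ideles of a function field. -/

/-- The places (primes) of `K`, given by their valuation rings. The trivial valuation is excluded.
For a function field in one variable over a finite field these are exactly the discrete
valuation rings of `K` with fraction field `K`. -/
def Place (K : Type u) [Field K] : Type u := {v : ValuationSubring K // v ≠ ⊤}

variable {K : Type u} [Field K]

/-- The completion `K_v` of `K` at the place `v`. -/
abbrev Place.Completion (v : Place K) : Type u := v.1.valuation.Completion

/-- The ring of integers `𝒪_v` of `K_v`. -/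
abbrev Place.integers (v : Place K) : ValuationSubring v.Completion :=
  (Valued.v : Valuation v.Completion _).valuationSubring

variable (K) in
/-- The adele ring `𝔸_K`: the restricted product of the `K_v` with respect to the `𝒪_v`, over all
places `v` of `K`. -/
abbrev AdeleRing : Type u := Πʳ v : Place K, [v.Completion, v.integers]

/-- The group `{a ∈ 𝒪_v^× : a ≡ 1 mod 𝔪_v ^ n}`, as a subgroup of `K_v^×`. For `n = 0` it is
`𝒪_v^×`. -/
def Place.units (v : Place K) (n : ℕ) : Subgroup v.Completionˣ :=
  (Units.map (Ideal.Quotient.mk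
    (IsLocalRing.maximalIdeal v.integers ^ n)).toMonoidHom).ker.map
    (Units.map v.integers.subtype.toMonoidHom)

/-- The embedding `K → K_v`. -/
def toCompletion (v : Place K) : K →+* v.Completion :=
  UniformSpace.Completion.coeRingHom.comp (WithVal.equiv v.1.valuation).symm.toRingHom

/-- The component `a_v ∈ K_v^×` of an idele `a`. -/
def component (v : Place K) : (AdeleRing K)ˣ →* v.Completionˣ :=
  Units.map (RestrictedProduct.evalRingHom _ v).toMonoidHom

variable (K) in
/-- The image of `K^×` in `𝔸_K^×`: the ideles `a` for which there is `f ∈ K^×` with `a_v = f` for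
all places `v`. -/
def principalIdeles : Subgroup (AdeleRing K)ˣ :=
  (MonoidHom.pi fun v : Place K => Units.map (toCompletion v).toMonoidHom).range.comap
    (MonoidHom.pi fun v : Place K => component v)

end Adeles

section LineBundles

/-! Line bundles on a scheme, their tensor products, and trivializations over an effective
divisor. -/

variable {X : Scheme.{u}}

/-- The stalk `L_x` of a sheaf of `𝒪_X`-modules, as a module over the local ring `𝒪_{X,x}`. -/
def Stalk (L : X.Modules) (x : X) : Type u := ↑(TopCat.Presheaf.stalk L.presheaf x)

instance (L : X.Modules) (x : X) : AddCommGroup (Stalk L x) :=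
  inferInstanceAs (AddCommGroup ↑(TopCat.Presheaf.stalk L.presheaf x))

instance (L : X.Modules) (x : X) : Module (X.presheaf.stalk x) (Stalk L x) :=
  let P : PresheafOfModules (X.presheaf ⋙ forget₂ CommRingCat RingCat) := L.val
  inferInstanceAs (Module (X.presheaf.stalk x) ↑(TopCat.Presheaf.stalk P.presheaf x))

/-- The germ at `x` of a section of `L`. -/
def germ (L : X.Modules) {U : X.Opens} {x : X} (hx : x ∈ U) : Γ(L, U) →+ Stalk L x :=
  (TopCat.Presheaf.germ L.presheaf U x hx).hom

lemma germ_smul (L : X.Modules) {U : X.Opens} {x : X} (hx : x ∈ U) (f : Γ(X, U)) (s : Γ(L, U)) :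
    germ L hx (f • s) = X.presheaf.germ U x hx f • germ L hx s :=
  PresheafOfModules.germ_smul (R := X.presheaf) L.val x U hx f s

/-- Restriction of sections of `L` to a smaller open set. -/
abbrev res (L : X.Modules) {U V : X.Opens} (h : V ≤ U) (s : Γ(L, U)) : Γ(L, V) :=
  L.presheaf.map (homOfLE h).op s

lemma germ_res (L : X.Modules) {U V : X.Opens} (h : V ≤ U) {x : X} (hx : x ∈ V) (s : Γ(L, U)) :
    germ L hx (res L h s) = germ L (h hx) s :=
  TopCat.Presheaf.germ_res_apply L.presheaf (homOfLE h) x hx s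

lemma res_res (L : X.Modules) {U V W : X.Opens} (h : V ≤ U) (h' : W ≤ V) (s : Γ(L, U)) :
    res L h' (res L h s) = res L (h'.trans h) s := by
  simp only [res, ← ConcreteCategory.comp_apply, ← Functor.map_comp]
  rfl

lemma exists_germ_eq (L : X.Modules) {x : X} (a : Stalk L x) :
    ∃ (U : X.Opens) (hx : x ∈ U) (s : Γ(L, U)), germ L hx s = a := by
  obtain ⟨U, hx, s, h⟩ := TopCat.Presheaf.exists_germ_eq (F := L.presheaf) a
  exact ⟨U, hx, s, h⟩

lemma germ_eq (L : X.Modules) {U V : X.Opens} {x : X} (hU : x ∈ U) (hV : x ∈ V)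
    {s : Γ(L, U)} {t : Γ(L, V)} (h : germ L hU s = germ L hV t) :
    ∃ (W : X.Opens) (_ : x ∈ W) (h₁ : W ≤ U) (h₂ : W ≤ V), res L h₁ s = res L h₂ t := by
  obtain ⟨W, hW, i, j, e⟩ := TopCat.Presheaf.germ_eq L.presheaf x hU hV s t h
  exact ⟨W, hW, i.le, j.le, e⟩

/-- The section `s` of `L` over `U` is a frame: multiplication by `s` is an isomorphism
`𝒪_X|_U ≅ L|_U`, i.e. `f ↦ f • s|_V` is a bijection `𝒪_X(V) → L(V)` for every open `V ⊆ U`. -/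
def IsFrame (L : X.Modules) {U : X.Opens} (s : Γ(L, U)) : Prop :=
  ∀ (V : X.Opens) (h : V ≤ U), Function.Bijective fun f : Γ(X, V) => f • res L h s

/-- A line bundle (invertible sheaf): a sheaf of `𝒪_X`-modules that is locally isomorphic
to `𝒪_X`. -/
def IsLineBundle (L : X.Modules) : Prop :=
  ∀ x : X, ∃ (U : X.Opens) (_ : x ∈ U) (s : Γ(L, U)), IsFrame L s

lemma IsFrame.restrict {L : X.Modules} {U V : X.Opens} {s : Γ(L, U)} (hs : IsFrame L s) (h : V ≤ U) :
    IsFrame L (res L h s) := by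
  intro W hW
  simpa only [res_res] using hs W (hW.trans h)

lemma res_smul (L : X.Modules) {U V : X.Opens} (h : V ≤ U) (f : Γ(X, U)) (s : Γ(L, U)) :
    res L h (f • s) = X.presheaf.map (homOfLE h).op f • res L h s :=
  Scheme.Modules.map_smul L (homOfLE h) f s

lemma IsFrame.germ_bijective {L : X.Modules} {U : X.Opens} {s : Γ(L, U)} (hs : IsFrame L s)
    {x : X} (hx : x ∈ U) :
    Function.Bijective fun a : X.presheaf.stalk x => a • germ L hx s := by
  constructor
  · refine (injective_iff_map_eq_zero
      (LinearMap.toSpanSingleton (X.presheaf.stalk x) (Stalk L x) (germ L hx s))).2 ?_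
    intro a ha
    obtain ⟨V, hV, f, rfl⟩ := TopCat.Presheaf.exists_germ_eq (F := X.presheaf) a
    have hW : x ∈ U ⊓ V := ⟨hx, hV⟩
    have h1 : germ L hW (X.presheaf.map (homOfLE (inf_le_right : U ⊓ V ≤ V)).op f •
        res L (inf_le_left : U ⊓ V ≤ U) s) = germ L hW 0 := by
      rw [germ_smul, germ_res, map_zero, TopCat.Presheaf.germ_res_apply]
      exact ha
    obtain ⟨W, hxW, h₁, h₂, e⟩ := germ_eq L hW hW h1
    rw [res_smul, res_res, show res L h₂ 0 = 0 from map_zero (L.presheaf.map _).hom] at e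
    have h0 := (hs W (h₁.trans inf_le_left)).1 (e.trans (zero_smul Γ(X, W) _).symm)
    rw [← ConcreteCategory.comp_apply, ← Functor.map_comp] at h0
    have := congrArg (X.presheaf.germ W x hxW) h0
    rw [map_zero] at this
    rw [← this]
    exact (TopCat.Presheaf.germ_res_apply X.presheaf
      (homOfLE (h₁.trans inf_le_right)) x hxW f).symm
  · intro a
    obtain ⟨V, hV, t, rfl⟩ := exists_germ_eq L a
    have hW : x ∈ U ⊓ V := ⟨hx, hV⟩
    obtain ⟨f, hf⟩ := (hs (U ⊓ V) inf_le_left).2 (res L (inf_le_right : U ⊓ V ≤ V) t)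
    replace hf : f • res L (inf_le_left : U ⊓ V ≤ U) s = res L (inf_le_right : U ⊓ V ≤ V) t := hf
    refine ⟨X.presheaf.germ (U ⊓ V) x hW f, ?_⟩
    have := congrArg (germ L hW) hf
    simpa only [germ_smul, germ_res] using this

/-- The presheaf `U ↦ L(U) ⊗_{𝒪_X(U)} M(U)`. -/
def tensorPresheaf (L M : X.Modules) : X.PresheafOfModules :=
  PresheafOfModules.Monoidal.tensorObj (R := X.presheaf) L.val M.val

/-- The tensor product `L ⊗ M` of sheaves of `𝒪_X`-modules: the sheaf associated with
`U ↦ L(U) ⊗_{𝒪_X(U)} M(U)`. -/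
def tensor (L M : X.Modules) : X.Modules :=
  (PresheafOfModules.sheafification (𝟙 X.ringCatSheaf.obj)).obj (tensorPresheaf L M)

/-- The canonical map from the tensor product presheaf to its associated sheaf. -/
def toTensor (L M : X.Modules) : (tensorPresheaf L M).presheaf ⟶ (tensor L M).presheaf :=
  toSheafify (Opens.grothendieckTopology X) (tensorPresheaf L M).presheaf

instance (L M : X.Modules) :
    Presheaf.IsLocallyInjective (Opens.grothendieckTopology X) (toTensor L M) :=
  inferInstanceAs (Presheaf.IsLocallyInjective (Opens.grothendieckTopology X)
    (toSheafify (Opens.grothendieckTopology X) (tensorPresheaf L M).presheaf))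

instance (L M : X.Modules) :
    Presheaf.IsLocallySurjective (Opens.grothendieckTopology X) (toTensor L M) :=
  inferInstanceAs (Presheaf.IsLocallySurjective (Opens.grothendieckTopology X)
    (toSheafify (Opens.grothendieckTopology X) (tensorPresheaf L M).presheaf))

/-- The section `s ⊗ t` of `L ⊗ M` given by sections `s` of `L` and `t` of `M`. -/
def tmul {L M : X.Modules} {U : X.Opens} (s : Γ(L, U)) (t : Γ(M, U)) : Γ(tensor L M, U) :=
  (toTensor L M).app (.op U) (TensorProduct.tmul Γ(X, U) s t)

/-- The canonical map `L(U) ⊗ M(U) → (L ⊗ M)(U)`, as a linear map. -/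
def tmulPre (L M : X.Modules) (U : X.Opens) :
    TensorProduct Γ(X, U) Γ(L, U) Γ(M, U) →ₗ[Γ(X, U)] Γ(tensor L M, U) :=
  (((PresheafOfModules.sheafificationAdjunction (𝟙 X.ringCatSheaf.obj)).unit.app
    (tensorPresheaf L M)).app (.op U)).hom

lemma tmul_eq {L M : X.Modules} {U : X.Opens} (s : Γ(L, U)) (t : Γ(M, U)) :
   tmul s t = tmulPre L M U (s ⊗ₜ[Γ(X, U)] t) := rfl

lemma tmulPre_injective (L M : X.Modules) (U : X.Opens) (a : TensorProduct Γ(X, U) Γ(L, U) Γ(M, U))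
  (h : tmulPre L M U a = 0) (x : X) (hx : x ∈ U) : ∃ (V : X.Opens) (hV : V ≤ U), x ∈ V ∧
     (tensorPresheaf L M).presheaf.map (homOfLE hV).op a = 0 := by
  have := Presheaf.equalizerSieve_mem (Opens.grothendieckTopology X) (toTensor L M) (X := .op U) a 0
     (by rw [map_zero]; exact h)
  obtain ⟨V, f, hf, hxV⟩ := this x hx
  exact ⟨V, f.le, hxV, hf.trans (map_zero _)⟩

lemma tmulPre_surjective (L M : X.Modules) (U : X.Opens) (y : Γ(tensor L M, U))
   (x : X) (hx : x ∈ U) : ∃ (V : X.Opens) (hV : V ≤ U), x ∈ V ∧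
     ∃ a, tmulPre L M V a = res _ hV y := by
  have := Presheaf.imageSieve_mem (Opens.grothendieckTopology X) (toTensor L M) (U := .op U) y
  obtain ⟨V, f, hf, hxV⟩ := this x hx
  exact ⟨V, f.le, hxV, hf⟩

lemma map_tmulPre_res (L M : X.Modules) {U V : X.Opens} (h : V ≤ U)
    (a : TensorProduct Γ(X, U) Γ(L, U) Γ(M, U)) :
    res _ h (tmulPre L M U a) =
      tmulPre L M V ((tensorPresheaf L M).presheaf.map (homOfLE h).op a) :=
  (NatTrans.naturality_apply (toTensor L M) (homOfLE h).op a).symm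

lemma res_tmul {L M : X.Modules} {U V : X.Opens} (h : V ≤ U) (s : Γ(L, U)) (t : Γ(M, U)) :
    res _ h (tmul s t) = tmul (res L h s) (res M h t) :=
  map_tmulPre_res L M h (s ⊗ₜ[Γ(X, U)] t)

lemma smul_tmul {L M : X.Modules} {U : X.Opens} (f g : Γ(X, U)) (s : Γ(L, U)) (t : Γ(M, U)) :
    tmul (f • s) (g • t) = (f * g) • tmul s t := by
  rw [tmul_eq, TensorProduct.smul_tmul_smul, map_smul]; rfl

/-- Frames `s`, `t` trivialize `L(U) ⊗ M(U)` by `f ↦ f • (s ⊗ t)`. -/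
def frameEquiv {L M : X.Modules} {U : X.Opens} {s : Γ(L, U)} {t : Γ(M, U)} (hs : IsFrame L s)
    (ht : IsFrame M t) : Γ(X, U) ≃ₗ[Γ(X, U)] TensorProduct Γ(X, U) Γ(L, U) Γ(M, U) :=
  have hs' : Function.Bijective (LinearMap.toSpanSingleton Γ(X, U) Γ(L, U) s) := by
    have := hs U le_rfl
    convert this using 2
    simp [res]
  have ht' : Function.Bijective (LinearMap.toSpanSingleton Γ(X, U) Γ(M, U) t) := by
    have := ht U le_rfl
    convert this using 2
    simp [res]
  (TensorProduct.lid _ _).symm.trans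
    (TensorProduct.congr (LinearEquiv.ofBijective _ hs') (LinearEquiv.ofBijective _ ht'))

lemma frameEquiv_apply {L M : X.Modules} {U : X.Opens} {s : Γ(L, U)} {t : Γ(M, U)}
   (hs : IsFrame L s) (ht : IsFrame M t) (f : Γ(X, U)) :
   frameEquiv hs ht f = f • (s ⊗ₜ[Γ(X, U)] t) := by
  simp [frameEquiv]

lemma tmul_injective {L M : X.Modules} {U : X.Opens} {s : Γ(L, U)} {t : Γ(M, U)}
    (hs : IsFrame L s) (ht : IsFrame M t) (f : Γ(X, U)) (hf : f • tmul s t = 0) : f = 0 := by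
  have h1 : tmulPre L M U (f • (s ⊗ₜ[Γ(X, U)] t)) = 0 := by rw [map_smul]; exact hf
  refine TopCat.Presheaf.section_ext X.sheaf U f 0 fun x hx => ?_
  obtain ⟨V, hV, hxV, h⟩ := tmulPre_injective L M U _ h1 x hx
  have h2 : (tensorPresheaf L M).presheaf.map (homOfLE hV).op (f • (s ⊗ₜ[Γ(X, U)] t)) =
     X.presheaf.map (homOfLE hV).op f • (res L hV s ⊗ₜ[Γ(X, V)] res M hV t) :=
    (tensorPresheaf L M).map_smul (homOfLE hV).op f (s ⊗ₜ[Γ(X, U)] t)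
  rw [h2, ← frameEquiv_apply (hs.restrict hV) (ht.restrict hV)] at h
  have h3 := (LinearEquiv.map_eq_zero_iff _).1 h
  have := congrArg (X.presheaf.germ V x hxV) h3
  rw [map_zero] at this
  refine Eq.trans ?_ (this.trans (map_zero (X.presheaf.germ U x hx).hom).symm)
  exact (TopCat.Presheaf.germ_res_apply X.presheaf (homOfLE hV) x hxV f).symm

lemma IsFrame.tensor {L M : X.Modules} {U : X.Opens} {s : Γ(L, U)} {t : Γ(M, U)}
    (hs : IsFrame L s) (ht : IsFrame M t) : IsFrame (GenPic.tensor L M) (tmul s t) := by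
  intro U' hU'
  rw [res_tmul]
  replace hs := hs.restrict hU'
  replace ht := ht.restrict hU'
  generalize res L hU' s = s at hs
  generalize res M hU' t = t at ht
  constructor
  · intro f g h
    rw [← sub_eq_zero]
    refine tmul_injective hs ht _ ?_
    rw [sub_smul]; exact sub_eq_zero.2 h
  · intro y
    have : ∀ x : U', ∃ (V : X.Opens) (hV : V ≤ U') (f : Γ(X, V)), x.1 ∈ V ∧
       f • res _ hV (tmul s t) = res _ hV y := by
      rintro ⟨x, hx⟩
      obtain ⟨V, hV, hxV, a, ha⟩ := tmulPre_surjective L M U' y x hx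
      obtain ⟨f, rfl⟩ := (frameEquiv (hs.restrict hV) (ht.restrict hV)).surjective a
      refine ⟨V, hV, f, hxV, ?_⟩
      rw [← ha, frameEquiv_apply, map_smul, res_tmul]
      rfl
    choose V hV f hxV hf using this
    have cov : U' ≤ ⨆ x, V x := fun x hx => Opens.mem_iSup.2 ⟨⟨x, hx⟩, hxV _⟩
    obtain ⟨g, hg, -⟩ := X.sheaf.existsUnique_gluing' V U' (fun x => homOfLE (hV x)) cov f (by
      intro i j
      have hij : V i ⊓ V j ≤ U' := inf_le_left.trans (hV i)
      let a : Γ(X, V i ⊓ V j) := X.presheaf.map (homOfLE inf_le_left).op (f i)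
      let b : Γ(X, V i ⊓ V j) := X.presheaf.map (homOfLE inf_le_right).op (f j)
      change a = b
      rw [← sub_eq_zero]
      refine tmul_injective (hs.restrict hij) (ht.restrict hij) _ ?_
      rw [sub_smul, sub_eq_zero, ← res_tmul]
      have h1 := congrArg (res _ (inf_le_left : V i ⊓ V j ≤ V i)) (hf i)
      have h2 := congrArg (res _ (inf_le_right : V i ⊓ V j ≤ V j)) (hf j)
      rw [res_smul, res_res, res_res] at h1 h2
      exact h1.trans h2.symm)
    refine ⟨g, ?_⟩
    refine TopCat.Sheaf.eq_of_locally_eq' ⟨_, (GenPic.tensor L M).isSheaf⟩ V U'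
      (fun x => homOfLE (hV x)) cov _ _ fun i => ?_
    let g' : Γ(X, U') := g
    change res _ (hV i) (g' • tmul s t) = res _ (hV i) y
    rw [res_smul, ← hf i]
    congr 1
    exact hg i

lemma IsLineBundle.tensor {L M : X.Modules} (hL : IsLineBundle L) (hM : IsLineBundle M) :
    IsLineBundle (tensor L M) := by
  intro x
  obtain ⟨U, hU, s, hs⟩ := hL x
  obtain ⟨V, hV, t, ht⟩ := hM x
  exact ⟨U ⊓ V, ⟨hU, hV⟩, _, (hs.restrict inf_le_left).tensor (ht.restrict inf_le_right)⟩

variable (X) in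
/-- The set `|X|` of closed points of `X`. -/
def ClosedPoint : Type u := {x : X // IsClosed ({x} : Set X)}

/-- The ideal `𝔪_x ^ n_x` of `𝒪_{X,x}`, for an effective divisor `D = ∑ n_x x` on `X`
(a finitely supported function on the closed points with values in `ℕ`). -/
abbrev modIdeal (D : ClosedPoint X →₀ ℕ) (x : ClosedPoint X) : Ideal (X.presheaf.stalk x.1) :=
  IsLocalRing.maximalIdeal (X.presheaf.stalk x.1) ^ D x

/-- The ring `𝒪_{X,x} / 𝔪_x ^ n_x`, i.e. the part of `𝒪|_D` at `x`. It is zero if `n_x = 0`. -/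
abbrev StructureFiber (D : ClosedPoint X →₀ ℕ) (x : ClosedPoint X) : Type u :=
  X.presheaf.stalk x.1 ⧸ modIdeal D x

/-- The module `L_x / 𝔪_x ^ n_x L_x`, i.e. the part of `L|_D` at `x`. It is zero if `n_x = 0`. -/
abbrev Fiber (L : X.Modules) (D : ClosedPoint X →₀ ℕ) (x : ClosedPoint X) : Type u :=
  Stalk L x.1 ⧸ (modIdeal D x • ⊤ : Submodule (X.presheaf.stalk x.1) (Stalk L x.1))

/-- The reduction map `L_x → L_x / 𝔪_x ^ n_x L_x`. -/
def toFiber (L : X.Modules) (D : ClosedPoint X →₀ ℕ) (x : ClosedPoint X) :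
    Stalk L x.1 →ₗ[X.presheaf.stalk x.1] Fiber L D x :=
  Submodule.mkQ _

/-- The isomorphism `𝒪_{X,x} / 𝔪_x ^ n_x ≅ L_x / 𝔪_x ^ n_x L_x` given by a frame of `L`. -/
def IsFrame.fiberEquiv {L : X.Modules} {U : X.Opens} {s : Γ(L, U)} (hs : IsFrame L s)
    (D : ClosedPoint X →₀ ℕ) (x : ClosedPoint X) (hx : x.1 ∈ U) :
    StructureFiber D x ≃ₗ[X.presheaf.stalk x.1] Fiber L D x :=
  Submodule.Quotient.equiv _ _
    (LinearEquiv.ofBijective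
      (LinearMap.toSpanSingleton (X.presheaf.stalk x.1) (Stalk L x.1) (germ L hx s))
      (hs.germ_bijective hx)) (by
    have : (modIdeal D x) = (modIdeal D x) • (⊤ : Submodule (X.presheaf.stalk x.1) _) := by simp
    conv_lhs => rw [this]
    rw [Submodule.map_smul'', Submodule.map_top, LinearEquiv.range])

lemma IsFrame.fiberEquiv_mk {L : X.Modules} {U : X.Opens} {s : Γ(L, U)} (hs : IsFrame L s)
    (D : ClosedPoint X →₀ ℕ) (x : ClosedPoint X) (hx : x.1 ∈ U) (a : X.presheaf.stalk x.1) :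
    hs.fiberEquiv D x hx (Ideal.Quotient.mk _ a) = toFiber L D x (a • germ L hx s) := rfl

lemma IsFrame.isUnit_triv {L : X.Modules} {U : X.Opens} {s : Γ(L, U)} (hs : IsFrame L s)
    {D : ClosedPoint X →₀ ℕ} {x : ClosedPoint X} (hx : x.1 ∈ U)
    (ψ : Fiber L D x ≃ₗ[X.presheaf.stalk x.1] StructureFiber D x) :
    IsUnit (ψ (toFiber L D x (germ L hx s))) := by
  obtain ⟨z, hz⟩ := ψ.surjective 1
  obtain ⟨a, rfl⟩ := (hs.fiberEquiv D x hx).surjective z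
  obtain ⟨a, rfl⟩ := Ideal.Quotient.mk_surjective a
  rw [hs.fiberEquiv_mk, map_smul, map_smul, Algebra.smul_def] at hz
  exact IsUnit.of_mul_eq_one_right _ hz

lemma exists_frames {L M : X.Modules} (hL : IsLineBundle L) (hM : IsLineBundle M) (x : X) :
    ∃ (U : X.Opens) (_ : x ∈ U) (s : Γ(L, U)) (t : Γ(M, U)), IsFrame L s ∧ IsFrame M t := by
  obtain ⟨U, hU, s, hs⟩ := hL x
  obtain ⟨V, hV, t, ht⟩ := hM x
  exact ⟨U ⊓ V, ⟨hU, hV⟩, _, _, hs.restrict inf_le_left, ht.restrict inf_le_right⟩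

lemma germ_tmul {L M : X.Modules} {x : X} {U V : X.Opens} (hU : x ∈ U) (hV : x ∈ V)
    {s : Γ(L, V)} {t : Γ(M, V)} {s' : Γ(L, U)} {t' : Γ(M, U)} {a b : X.presheaf.stalk x}
    (ha : germ L hU s' = a • germ L hV s) (hb : germ M hU t' = b • germ M hV t) :
    germ (tensor L M) hU (tmul s' t') = (a * b) • germ (tensor L M) hV (tmul s t) := by
  obtain ⟨A, hA, f, rfl⟩ := TopCat.Presheaf.exists_germ_eq (F := X.presheaf) a
  obtain ⟨B, hB, g, rfl⟩ := TopCat.Presheaf.exists_germ_eq (F := X.presheaf) b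
  have hW : x ∈ (A ⊓ B) ⊓ V := ⟨⟨hA, hB⟩, hV⟩
  obtain ⟨W, hWA, hWB, hWV, hxW⟩ : ∃ W : X.Opens, W ≤ A ∧ W ≤ B ∧ W ≤ V ∧ x ∈ W :=
    ⟨(A ⊓ B) ⊓ V, inf_le_left.trans inf_le_left, inf_le_left.trans inf_le_right, inf_le_right, hW⟩
  have ha' : germ L hU s' =
      germ L hxW (X.presheaf.map (homOfLE hWA).op f • res L hWV s) := by
    rw [ha, germ_smul, germ_res, TopCat.Presheaf.germ_res_apply]
  have hb' : germ M hU t' =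
      germ M hxW (X.presheaf.map (homOfLE hWB).op g • res M hWV t) := by
    rw [hb, germ_smul, germ_res, TopCat.Presheaf.germ_res_apply]
  obtain ⟨W₁, hx₁, i₁, j₁, e₁⟩ := germ_eq L hU hxW ha'
  obtain ⟨W₂, hx₂, i₂, j₂, e₂⟩ := germ_eq M hU hxW hb'
  have hx : x ∈ W₁ ⊓ W₂ := ⟨hx₁, hx₂⟩
  have e₁' := congrArg (res L (inf_le_left : W₁ ⊓ W₂ ≤ W₁)) e₁
  have e₂' := congrArg (res M (inf_le_right : W₁ ⊓ W₂ ≤ W₂)) e₂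
  rw [res_res, res_res] at e₁' e₂'
  rw [← germ_res _ (inf_le_left.trans i₁ : W₁ ⊓ W₂ ≤ U) hx, res_tmul, e₁', e₂', ← res_tmul,
    smul_tmul, germ_res, germ_smul, ← res_tmul, germ_res, map_mul,
    TopCat.Presheaf.germ_res_apply, TopCat.Presheaf.germ_res_apply]

lemma res_app {L M : X.Modules} (f : L ⟶ M) {U V : X.Opens} (h : V ≤ U) (s : Γ(L, U)) :
    res M h (f.app U s) = f.app V (res L h s) :=
  (NatTrans.naturality_apply f.mapPresheaf (homOfLE h).op s).symm

/-- Functoriality of the tensor product presheaf for isomorphisms. -/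
def tensorPresheafIso {L L' M M' : X.Modules} (f : L ≅ L') (g : M ≅ M') :
    tensorPresheaf L M ≅ tensorPresheaf L' M' :=
  MonoidalCategory.tensorIso (C := PresheafOfModules (X.presheaf ⋙ forget₂ CommRingCat RingCat))
    ((Scheme.Modules.toPresheafOfModules X).mapIso f)
    ((Scheme.Modules.toPresheafOfModules X).mapIso g)

/-- The isomorphism `f ⊗ g : L ⊗ M ≅ L' ⊗ M'`. -/
def tensorIso {L L' M M' : X.Modules} (f : L ≅ L') (g : M ≅ M') : tensor L M ≅ tensor L' M' :=
  (PresheafOfModules.sheafification (𝟙 X.ringCatSheaf.obj)).mapIso (tensorPresheafIso f g)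

lemma tensorIso_tmul {L L' M M' : X.Modules} (f : L ≅ L') (g : M ≅ M') {U : X.Opens}
    (s : Γ(L, U)) (t : Γ(M, U)) :
    (tensorIso f g).hom.app U (tmul s t) = tmul (f.hom.app U s) (g.hom.app U t) :=
  (ConcreteCategory.congr_hom (NatTrans.congr_app (toSheafify_naturality
    (Opens.grothendieckTopology X) ((PresheafOfModules.toPresheaf _).map
      (tensorPresheafIso f g).hom)) (Opposite.op U)) (s ⊗ₜ[Γ(X, U)] t)).symm

lemma exists_tensor_triv {L M : X.Modules} (hL : IsLineBundle L) (hM : IsLineBundle M)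
    {D : ClosedPoint X →₀ ℕ} {x : ClosedPoint X}
    (φ : Fiber L D x ≃ₗ[X.presheaf.stalk x.1] StructureFiber D x)
    (ψ : Fiber M D x ≃ₗ[X.presheaf.stalk x.1] StructureFiber D x) :
    ∃ χ : Fiber (tensor L M) D x ≃ₗ[X.presheaf.stalk x.1] StructureFiber D x,
      ∀ (U : X.Opens) (hx : x.1 ∈ U) (s : Γ(L, U)) (t : Γ(M, U)),
        χ (toFiber _ D x (germ _ hx (tmul s t))) =
          φ (toFiber L D x (germ L hx s)) * ψ (toFiber M D x (germ M hx t)) := by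
  obtain ⟨W, hW, s, t, hs, ht⟩ := exists_frames hL hM x.1
  have hu := (hs.isUnit_triv hW φ).mul (ht.isUnit_triv hW ψ)
  refine ⟨((hs.tensor ht).fiberEquiv D x hW).symm.trans
    (hu.unit.mulLeftLinearEquiv (X.presheaf.stalk x.1) _), fun U hx s' t' => ?_⟩
  obtain ⟨a, ha⟩ := (hs.germ_bijective hW).2 (germ L hx s')
  obtain ⟨b, hb⟩ := (ht.germ_bijective hW).2 (germ M hx t')
  have key : germ (tensor L M) hx (tmul s' t') = (a * b) • germ (tensor L M) hW (tmul s t) :=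
    germ_tmul hx hW ha.symm hb.symm
  have key' : toFiber (tensor L M) D x (germ _ hx (tmul s' t')) =
      (hs.tensor ht).fiberEquiv D x hW (Ideal.Quotient.mk _ (a * b)) := by
    rw [key, IsFrame.fiberEquiv_mk]
  rw [key', LinearEquiv.trans_apply, LinearEquiv.symm_apply_apply, ← ha, ← hb]
  simp only [map_smul, Algebra.smul_def, Units.mulLeftLinearEquiv_apply, IsUnit.unit_spec, map_mul,
    Ideal.Quotient.algebraMap_eq]
  ring

/-- A pair `(L, ψ)` of a line bundle `L` on `X` and a trivialization `ψ : L|_D ≅ 𝒪|_D` over `D`,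
i.e. isomorphisms `ψ_x : L_x / 𝔪_x ^ n_x L_x ≅ 𝒪_{X,x} / 𝔪_x ^ n_x` of `𝒪_{X,x}`-modules. For a point
`x` outside the support of `D` both modules are zero, so that there `ψ_x` carries no information. -/
structure TrivializedLineBundle (D : ClosedPoint X →₀ ℕ) where
  L : X.Modules
  isLineBundle : IsLineBundle L
  triv : ∀ x : ClosedPoint X, Fiber L D x ≃ₗ[X.presheaf.stalk x.1] StructureFiber D x

namespace TrivializedLineBundle
variable {D : ClosedPoint X →₀ ℕ}

/-- The value `ψ_x(s|_D)` of the trivialization on a section `s` of the line bundle near `x`. -/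
def restrict (P : TrivializedLineBundle D) (x : ClosedPoint X) {U : X.Opens} (hx : x.1 ∈ U)
    (s : Γ(P.L, U)) : StructureFiber D x :=
  P.triv x (toFiber P.L D x (germ P.L hx s))

lemma restrict_smul (P : TrivializedLineBundle D) (x : ClosedPoint X) {U : X.Opens} (hx : x.1 ∈ U)
    (f : Γ(X, U)) (s : Γ(P.L, U)) :
    P.restrict x hx (f • s) = X.presheaf.germ U x.1 hx f • P.restrict x hx s := by
  simp only [restrict, germ_smul, map_smul]

lemma restrict_res (P : TrivializedLineBundle D) (x : ClosedPoint X) {U V : X.Opens} (h : V ≤ U)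
    (hx : x.1 ∈ V) (s : Γ(P.L, U)) :
    P.restrict x hx (res P.L h s) = P.restrict x (h hx) s := by
  simp only [restrict, germ_res]

/-- The tensor product `(L, ψ) ⊗ (L', ψ') = (L ⊗ L', ψ'')`, where `ψ''` is the trivialization with
`ψ''(s ⊗ t) = ψ(s) ψ'(t)` for all local sections `s`, `t` (these values determine `ψ''`). -/
def tensor (P Q : TrivializedLineBundle D) : TrivializedLineBundle D where
  L := GenPic.tensor P.L Q.L
  isLineBundle := P.isLineBundle.tensor Q.isLineBundle
  triv x := (exists_tensor_triv P.isLineBundle Q.isLineBundle (P.triv x) (Q.triv x)).choose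

lemma restrict_tmul (P Q : TrivializedLineBundle D) (x : ClosedPoint X) {U : X.Opens}
    (hx : x.1 ∈ U) (s : Γ(P.L, U)) (t : Γ(Q.L, U)) :
    (P.tensor Q).restrict x hx (tmul s t) = P.restrict x hx s * Q.restrict x hx t :=
  (exists_tensor_triv P.isLineBundle Q.isLineBundle (P.triv x) (Q.triv x)).choose_spec U hx s t

/-- Two pairs `(L, ψ)` and `(L', ψ')` are equivalent if there is an isomorphism `θ : L ≅ L'` such
that `ψ' ∘ θ|_D = ψ`. -/
def Equivalent (P Q : TrivializedLineBundle D) : Prop :=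
  ∃ θ : P.L ≅ Q.L, ∀ (x : ClosedPoint X) (U : X.Opens) (hx : x.1 ∈ U) (s : Γ(P.L, U)),
    Q.restrict x hx (θ.hom.app U s) = P.restrict x hx s

variable (D) in
instance setoid : Setoid (TrivializedLineBundle D) where
  r := Equivalent
  iseqv :=
    { refl := fun P => ⟨Iso.refl _, fun _ _ _ _ => rfl⟩
      symm := by
        rintro P Q ⟨θ, h⟩
        refine ⟨θ.symm, fun x U hx s => ?_⟩
        rw [← h, ← ConcreteCategory.comp_apply, ← Scheme.Modules.Hom.comp_app]
        simp
      trans := by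
        rintro P Q R ⟨θ, h⟩ ⟨η, k⟩
        refine ⟨θ ≪≫ η, fun x U hx s => ?_⟩
        rw [← h, ← k]
        rfl }

lemma Equivalent.tensor {P P' Q Q' : TrivializedLineBundle D} (h : P.Equivalent P')
    (k : Q.Equivalent Q') : (P.tensor Q).Equivalent (P'.tensor Q') := by
  obtain ⟨θ, h⟩ := h
  obtain ⟨η, k⟩ := k
  refine ⟨tensorIso θ η, fun x U hx (y : Γ(GenPic.tensor P.L Q.L, U)) => ?_⟩
  obtain ⟨W, hW, s, t, hs, ht⟩ := exists_frames P.isLineBundle Q.isLineBundle x.1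
  have hUW : x.1 ∈ W ⊓ U := ⟨hW, hx⟩
  obtain ⟨f, hf⟩ := (hs.tensor ht (W ⊓ U) inf_le_left).2
    (res (GenPic.tensor P.L Q.L) (inf_le_right : W ⊓ U ≤ U) y)
  replace hf : f • res _ (inf_le_left : W ⊓ U ≤ W) (tmul s t) =
    res (GenPic.tensor P.L Q.L) (inf_le_right : W ⊓ U ≤ U) y := hf
  refine (restrict_res (P'.tensor Q') x (inf_le_right : W ⊓ U ≤ U) hUW _).symm.trans
    (Eq.trans ?_ (restrict_res (P.tensor Q) x (inf_le_right : W ⊓ U ≤ U) hUW y))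
  refine (congrArg (restrict (P'.tensor Q') x hUW)
    (res_app (tensorIso θ η).hom (inf_le_right : W ⊓ U ≤ U) y)).trans ?_
  change restrict (P'.tensor Q') x hUW ((tensorIso θ η).hom.app (W ⊓ U)
    (res (GenPic.tensor P.L Q.L) (inf_le_right : W ⊓ U ≤ U) y)) =
    restrict (P.tensor Q) x hUW (res (GenPic.tensor P.L Q.L) (inf_le_right : W ⊓ U ≤ U) y)
  rw [← hf, res_tmul, Scheme.Modules.Hom.app_smul, tensorIso_tmul]
  refine (restrict_smul (P'.tensor Q') x hUW f _).trans
    (Eq.trans ?_ (restrict_smul (P.tensor Q) x hUW f _).symm)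
  rw [restrict_tmul, restrict_tmul, h, k]

end TrivializedLineBundle

/-- The set of equivalence classes of line bundles on `X` with a trivialization over `D`. -/
def PicD (D : ClosedPoint X →₀ ℕ) : Type (u + 1) := Quotient (TrivializedLineBundle.setoid D)

/-- The operation `[(L, ψ)] ⊗ [(L', ψ')]` on equivalence classes. -/
def PicD.tensor {D : ClosedPoint X →₀ ℕ} : PicD D → PicD D → PicD D :=
  Quotient.map₂ TrivializedLineBundle.tensor fun _ _ h _ _ k => h.tensor k

end LineBundles

section IdeleClasses

/-! The idele class group attached to an effective divisor on an integral scheme. -/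

variable {X : Scheme.{u}} [IsIntegral X]

/-- `v` is the place of the function field given by the closed point `x`: the valuation ring of
`v` is the local ring of `X` at `x`. -/
def IsPlaceOf (v : Place X.functionField) (x : ClosedPoint X) : Prop :=
  ∀ f : X.functionField,
    f ∈ v.1 ↔ f ∈ (algebraMap (X.presheaf.stalk x.1) X.functionField).range

/-- The group `𝕆_D^×`, for `D = ∑ n_x x`: the ideles `a` with `a_v ∈ 𝒪_v^×` for all places `v`,
and `a_v ≡ 1 mod 𝔪_v ^ n_x` if `v` is the place of the closed point `x`. -/
def congruenceUnits (D : ClosedPoint X →₀ ℕ) : Subgroup (AdeleRing X.functionField)ˣ :=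
  (⨅ v : Place X.functionField, (v.units 0).comap (component v)) ⊓
    ⨅ (v : Place X.functionField) (x : ClosedPoint X) (_ : IsPlaceOf v x),
      (v.units (D x)).comap (component v)

/-- The idele class group `K^× \ 𝔸_K^× / 𝕆_D^×`. -/
abbrev IdeleClassGroup (D : ClosedPoint X →₀ ℕ) : Type u :=
  (AdeleRing X.functionField)ˣ ⧸ (principalIdeles X.functionField ⊔ congruenceUnits D)

end IdeleClasses

end GenPic

end

/-!
For a complete regular curve `X` over a finite field, a closed point is the same thing as a place of
the function field `K`: the local rings are discrete valuation rings, and the valuative criterion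
says that every place has exactly one center (`isCompleteRegularCurve`). The finiteness of the base
field enters because it makes every valuation ring of `K` contain the constants.

The group structure on `Pic_D` is transported along a bijection with the idele class group that is
compatible with the tensor product. This bijection is best described by the relation `Represents`:
an idele `a` represents `(L, ψ)` if, after the choice of a basis `e` of the generic stalk of `L`, one
has `a_x f ≡ 1` modulo `𝔪_x ^ n_x` for a frame `s = f e` of `L` at `x` with `ψ_x(s) = 1`, for each
closed point `x`. A change of `e` changes `a` by a principal idele, and a change of the frames
changes it by an element of `𝕆_D^×` (`Represents.mul`). Each pair is represented by an idele
(`exists_represents`), because a frame on a nonempty open set misses only finitely many points, and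
tensor products of pairs correspond to products of ideles (`Represents.tensor`), since tensor
products of frames are frames.

In the other direction, an idele `a` defines the line bundle `ideleSheaf a` of rational functions
`r` with `a_x r ∈ 𝒪_x`. It is locally free because `K` is dense in `K_x` and almost all components
of `a` are units. Its frames `f` with `a_x f ≡ 1` define a trivialization over `D`
(`ideleBundle`). A pair represented by `a` is isomorphic to `ideleBundle D a`, by taking coordinates
with respect to `e` (`Represents.equivalent`), and an isomorphism between two bundles of this form
is multiplication by a rational function, so that `a` and `b` give isomorphic pairs exactly if they
have the same idele class (`ideleBundle_equivalent_iff`).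
-/

noncomputable section

namespace GenPic

/-! ### The local theory at a place -/

section Valuations

variable {K : Type u} [Field K] (v : Place K)

lemma valued_toCompletion (f : K) : Valued.v (toCompletion v f) = v.1.valuation f :=
  Valued.valuedCompletion_apply (WithVal.toVal v.1.valuation f)

lemma valued_toCompletion_le_one_iff (f : K) : Valued.v (toCompletion v f) ≤ 1 ↔ f ∈ v.1 := by
  rw [valued_toCompletion, ValuationSubring.valuation_le_one_iff]

/-- `K` is dense in `K_v`. -/
lemma exists_valued_sub_toCompletion_lt (b : v.Completion) {g : K} (hg : g ≠ 0) :
    ∃ f : K, Valued.v (toCompletion v f - b) < v.1.valuation g := by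
  have hd : DenseRange (toCompletion v) :=
    UniformSpace.Completion.denseRange_coe.comp
      (WithVal.equiv v.1.valuation).symm.surjective.denseRange
      (UniformSpace.Completion.continuous_coe _)
  have ho : {y : v.Completion | Valued.v.restrict (y - b) <
      Valued.v.restrict (toCompletion v g)} ∈ nhds b := by
    refine ((Valued.isOpen_ball (R := v.Completion) _).preimage
      (continuous_sub_right b)).mem_nhds (x := b) ?_
    change Valued.v.restrict (b - b) < _
    rw [Valuation.restrict_lt_iff, valued_toCompletion, sub_self, map_zero]
    exact zero_lt_iff.2 ((Valuation.ne_zero_iff _).2 hg)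
  obtain ⟨_, h, f, rfl⟩ := mem_closure_iff_nhds.1 (hd b) _ ho
  refine ⟨f, ?_⟩
  have := (Valuation.restrict_lt_iff _).1 h
  rwa [valued_toCompletion] at this

variable {v} in
lemma mem_units_iff {n : ℕ} {a : v.Completionˣ} :
    a ∈ v.units n ↔ ∃ c : v.integers, (c : v.Completion) = a ∧ IsUnit c ∧
      c - 1 ∈ IsLocalRing.maximalIdeal v.integers ^ n := by
  constructor
  · rintro ⟨c, hc, rfl⟩
    refine ⟨c, rfl, c.isUnit, ?_⟩
    rw [← Ideal.Quotient.eq, map_one]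
    exact congrArg Units.val hc
  · rintro ⟨_, hc, ⟨c, rfl⟩, h⟩
    refine ⟨c, ?_, Units.ext hc⟩
    rw [← Ideal.Quotient.eq, map_one] at h
    exact Units.ext h

lemma isUnit_integers_iff (c : v.integers) : IsUnit c ↔ Valued.v (c : v.Completion) = 1 :=
  (Valuation.integer.integers _).isUnit_iff_valuation_eq_one

lemma dvd_integers_iff (c d : v.integers) :
    c ∣ d ↔ Valued.v (d : v.Completion) ≤ Valued.v (c : v.Completion) :=
  (Valuation.integer.integers (Valued.v : Valuation v.Completion _)).dvd_iff_le

lemma mem_units_zero_iff {a : v.Completionˣ} :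
    a ∈ v.units 0 ↔ Valued.v (a : v.Completion) = 1 := by
  rw [mem_units_iff]
  constructor
  · rintro ⟨c, hc, hu, -⟩
    rw [← hc]
    exact (isUnit_integers_iff v c).1 hu
  · intro h
    refine ⟨⟨a, h.le⟩, rfl, ?_, by simp⟩
    exact (isUnit_integers_iff v _).2 h

lemma units_le_units_zero (n : ℕ) : v.units n ≤ v.units 0 := by
  intro a ha
  rw [mem_units_iff] at ha ⊢
  obtain ⟨c, hc, hu, -⟩ := ha
  exact ⟨c, hc, hu, by simp⟩

variable {v} {R : Type u} [CommRing R] [IsDomain R] [IsDiscreteValuationRing R] [Algebra R K]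
  [IsFractionRing R K] (hv : ∀ f : K, f ∈ v.1 ↔ f ∈ (algebraMap R K).range)

include hv

omit [IsDomain R] [IsDiscreteValuationRing R] [IsFractionRing R K] in
lemma valued_algebraMap_le_one (c : R) :
    Valued.v (toCompletion v (algebraMap R K c)) ≤ 1 :=
  (valued_toCompletion_le_one_iff v _).2 ((hv _).2 ⟨c, rfl⟩)

omit [IsDiscreteValuationRing R] in
lemma valued_algebraMap_eq_one_iff {c : R} :
    Valued.v (toCompletion v (algebraMap R K c)) = 1 ↔ IsUnit c := by
  constructor
  · intro h
    have hc : algebraMap R K c ≠ 0 := fun h0 => by simp [h0] at h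
    have h' : Valued.v (toCompletion v (algebraMap R K c)⁻¹) ≤ 1 := by
      rw [map_inv₀, map_inv₀, h, inv_one]
    obtain ⟨d, hd⟩ := (hv _).1 ((valued_toCompletion_le_one_iff v _).1 h')
    refine IsUnit.of_mul_eq_one d (IsFractionRing.injective R K ?_)
    rw [map_mul, map_one, hd, mul_inv_cancel₀ hc]
  · rintro ⟨c, rfl⟩
    refine le_antisymm (valued_algebraMap_le_one hv _) ?_
    have h := valued_algebraMap_le_one hv (↑c⁻¹ : R)
    have h1 : Valued.v (toCompletion v (algebraMap R K c)) *
        Valued.v (toCompletion v (algebraMap R K ↑c⁻¹)) = 1 := by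
      simp
    calc (1 : v.1.ValueGroup) = _ := h1.symm
      _ ≤ _ := mul_le_of_le_one_right' h

/-- A uniformizer of `R` generates the maximal ideal of the completed ring `𝒪_v`. -/
lemma maximalIdeal_integers_eq_span {ϖ : R} (hϖ : Irreducible ϖ) :
    IsLocalRing.maximalIdeal v.integers =
      Ideal.span {⟨toCompletion v (algebraMap R K ϖ), valued_algebraMap_le_one hv ϖ⟩} := by
  have hϖ0 : algebraMap R K ϖ ≠ 0 := by
    simpa using hϖ.ne_zero
  refine le_antisymm ?_ ?_
  · intro a ha
    have ha1 : Valued.v (a : v.Completion) < 1 :=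
      lt_of_le_of_ne a.2 fun h => (IsLocalRing.mem_maximalIdeal _).1 ha
        ((isUnit_integers_iff v _).2 h)
    -- An element of `K` that is closer than `ϖ` to `a` lies in `(ϖ)`.
    obtain ⟨f, hf⟩ := exists_valued_sub_toCompletion_lt v (a : v.Completion) hϖ0
    rw [← valued_toCompletion] at hf
    have hϖ1 := valued_algebraMap_le_one hv ϖ
    have hfv : Valued.v (toCompletion v f) < 1 := by
      have : toCompletion v f = (toCompletion v f - a) + a := by ring
      rw [this]
      exact Valuation.map_add_lt _ (hf.trans_le hϖ1) ha1
    obtain ⟨c, rfl⟩ := (hv _).1 ((valued_toCompletion_le_one_iff v _).1 hfv.le)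
    have hc : c ∈ IsLocalRing.maximalIdeal R := fun hu =>
      hfv.ne ((valued_algebraMap_eq_one_iff hv).2 hu)
    rw [hϖ.maximalIdeal_eq, Ideal.mem_span_singleton] at hc
    obtain ⟨d, rfl⟩ := hc
    have hle : Valued.v (a : v.Completion) ≤ Valued.v (toCompletion v (algebraMap R K ϖ)) := by
      have : (a : v.Completion) = toCompletion v (algebraMap R K (ϖ * d)) -
        (toCompletion v (algebraMap R K (ϖ * d)) - a) := by ring
      rw [this]
      refine Valuation.map_sub_le _ ?_ hf.le
      rw [map_mul, map_mul, map_mul]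
      exact mul_le_of_le_one_right' (valued_algebraMap_le_one hv d)
    exact Ideal.mem_span_singleton.2 ((dvd_integers_iff v _ _).2 hle)
  · rw [Ideal.span_le, Set.singleton_subset_iff]
    refine (IsLocalRing.mem_maximalIdeal _).2 fun hu => ?_
    rw [isUnit_integers_iff] at hu
    exact hϖ.not_isUnit ((valued_algebraMap_eq_one_iff hv).1 hu)

/-- The subgroup `1 + 𝔪_v ^ n` of `𝒪_v^×` is described by the valuation. -/
lemma mem_units_iff_valued {ϖ : R} (hϖ : Irreducible ϖ) {n : ℕ} {a : v.Completionˣ} :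
    a ∈ v.units n ↔ Valued.v (a : v.Completion) = 1 ∧
      Valued.v ((a : v.Completion) - 1) ≤ Valued.v (toCompletion v (algebraMap R K (ϖ ^ n))) := by
  have hle (c : v.integers) : c ∈ IsLocalRing.maximalIdeal v.integers ^ n ↔
      Valued.v (c : v.Completion) ≤ Valued.v (toCompletion v (algebraMap R K (ϖ ^ n))) := by
    rw [maximalIdeal_integers_eq_span hv hϖ, Ideal.span_singleton_pow, Ideal.mem_span_singleton]
    rw [dvd_integers_iff, map_pow, map_pow]
    rfl
  rw [mem_units_iff]
  constructor
  · rintro ⟨c, hc, hu, h⟩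
    rw [hle] at h
    rw [← hc]
    exact ⟨(isUnit_integers_iff v _).1 hu, h⟩
  · rintro ⟨h1, h2⟩
    exact ⟨⟨a, h1.le⟩, rfl, (isUnit_integers_iff v _).2 h1, (hle _).2 h2⟩

/-- `K^× ∩ (1 + 𝔪_v ^ n)`, computed in the completion, is the image of the units of `R` that are
congruent to `1`. -/
lemma map_toCompletion_mem_units_iff {n : ℕ} {f : Kˣ} :
    Units.map (toCompletion v).toMonoidHom f ∈ v.units n ↔ ∃ c : R, IsUnit c ∧
      algebraMap R K c = f ∧ Ideal.Quotient.mk (IsLocalRing.maximalIdeal R ^ n) c = 1 := by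
  obtain ⟨ϖ, hϖ⟩ := IsDiscreteValuationRing.exists_irreducible R
  have hϖ0 : algebraMap R K (ϖ ^ n) ≠ 0 := by
    simpa using fun h => (hϖ.ne_zero h).elim
  have key (c : R) : Valued.v (toCompletion v (algebraMap R K c) - 1) ≤
      Valued.v (toCompletion v (algebraMap R K (ϖ ^ n))) ↔
      Ideal.Quotient.mk (IsLocalRing.maximalIdeal R ^ n) c = 1 := by
    rw [← map_one (Ideal.Quotient.mk _), Ideal.Quotient.eq, hϖ.maximalIdeal_eq,
      Ideal.span_singleton_pow, Ideal.mem_span_singleton, ← map_one (toCompletion v), ← map_sub,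
      ← map_one (algebraMap R K), ← map_sub]
    constructor
    · intro h
      have h2 : Valued.v (toCompletion v (algebraMap R K (c - 1) / algebraMap R K (ϖ ^ n))) ≤ 1 := by
        rw [map_div₀, map_div₀]
        exact div_le_one_of_le₀ h zero_le
      obtain ⟨d, hd⟩ := (hv _).1 ((valued_toCompletion_le_one_iff v _).1 h2)
      refine ⟨d, IsFractionRing.injective R K ?_⟩
      rw [map_mul, hd, mul_div_cancel₀ _ hϖ0]
    · rintro ⟨d, hd⟩
      rw [hd, map_mul, map_mul, map_mul]
      exact mul_le_of_le_one_right' (valued_algebraMap_le_one hv d)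
  rw [mem_units_iff_valued hv hϖ]
  change Valued.v (toCompletion v f) = 1 ∧ Valued.v (toCompletion v f - 1) ≤ _ ↔ _
  constructor
  · rintro ⟨h1, h2⟩
    obtain ⟨c, hc⟩ := (hv _).1 ((valued_toCompletion_le_one_iff v _).1 h1.le)
    rw [← hc] at h1 h2
    exact ⟨c, (valued_algebraMap_eq_one_iff hv).1 h1, hc, (key c).1 h2⟩
  · rintro ⟨c, hu, hc, h⟩
    rw [← hc]
    exact ⟨(valued_algebraMap_eq_one_iff hv).2 hu, (key c).2 h⟩

/-- Weak approximation at one place: `K_v^× = K^× (1 + 𝔪_v ^ n)`. -/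
lemma exists_mul_toCompletion_mem_units (n : ℕ) (a : v.Completionˣ) :
    ∃ f : Kˣ, a * Units.map (toCompletion v).toMonoidHom f ∈ v.units n := by
  obtain ⟨ϖ, hϖ⟩ := IsDiscreteValuationRing.exists_irreducible R
  have hϖ0 : algebraMap R K ϖ ≠ 0 := by simpa using hϖ.ne_zero
  have hϖ1 : Valued.v (toCompletion v (algebraMap R K ϖ)) ≤ 1 := valued_algebraMap_le_one hv ϖ
  -- `g ∈ K` with the same valuation as `a⁻¹`
  obtain ⟨g, hg⟩ : ∃ g : K, Valued.v (↑a⁻¹ : v.Completion) = v.1.valuation g :=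
    Valued.exists_coe_eq_v (K := WithVal v.1.valuation) _ |>.imp' WithVal.ofVal fun g hg => hg
  have hg0 : g ≠ 0 := by
    rintro rfl
    simp at hg
  obtain ⟨f, hf⟩ := exists_valued_sub_toCompletion_lt v (↑a⁻¹ : v.Completion)
    (mul_ne_zero hg0 (pow_ne_zero n hϖ0))
  have hlt : Valued.v ((a : v.Completion) * toCompletion v f - 1) <
      Valued.v (toCompletion v (algebraMap R K (ϖ ^ n))) := by
    have : (a : v.Completion) * toCompletion v f - 1 = a * (toCompletion v f - ↑a⁻¹) := by
      rw [mul_sub, Units.mul_inv]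
    rw [this, map_mul, valued_toCompletion]
    rw [map_mul, ← hg] at hf
    have hpos : (0 : v.1.ValueGroup) < Valued.v (a : v.Completion) :=
      zero_lt_iff.2 ((Valuation.ne_zero_iff _).2 a.ne_zero)
    calc _ < Valued.v (a : v.Completion) *
        (Valued.v (↑a⁻¹ : v.Completion) * v.1.valuation (algebraMap R K ϖ ^ n)) :=
          mul_lt_mul_of_pos_left hf hpos
      _ = _ := by
        rw [← mul_assoc, ← map_mul Valued.v, Units.mul_inv, map_one, one_mul, map_pow (algebraMap R K)]
  have h1 : Valued.v ((a : v.Completion) * toCompletion v f) = 1 := by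
    have h2 : Valued.v ((a : v.Completion) * toCompletion v f - 1) <
        Valued.v (1 : v.Completion) := by
      rw [map_one]
      refine hlt.trans_le ?_
      rw [map_pow, map_pow, map_pow]
      exact pow_le_one' hϖ1 n
    have := Valuation.map_add_eq_of_lt_left _ h2
    rwa [add_sub_cancel, map_one] at this
  have hf0 : f ≠ 0 := by
    rintro rfl
    simp at h1
  exact ⟨Units.mk0 f hf0, (mem_units_iff_valued hv hϖ).2 ⟨h1, hlt.le⟩⟩

end Valuations

section Ideles

variable {K : Type u} [Field K]

lemma finite_component_notMem_units (a : (AdeleRing K)ˣ) :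
    {v : Place K | component v a ∉ v.units 0}.Finite := by
  have h1 := (a : AdeleRing K).eventually
  have h2 := (↑a⁻¹ : AdeleRing K).eventually
  refine Filter.mem_cofinite.1 ?_ |>.subset (s := {v | component v a ∈ v.units 0}ᶜ) fun _ h => h
  filter_upwards [h1, h2] with v h1 h2
  refine (mem_units_zero_iff v).2 ?_
  refine le_antisymm h1 ?_
  have h3 : Valued.v (component v a : v.Completion) *
      Valued.v (↑(component v a)⁻¹ : v.Completion) = 1 := by
    rw [← map_mul, Units.mul_inv, map_one]
  calc (1 : v.1.ValueGroup) = _ := h3.symm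
    _ ≤ _ := mul_le_of_le_one_right' h2

/-- A family `a_v ∈ K_v^×` with `a_v ∈ 𝒪_v^×` for almost all `v` is an idele. -/
lemma exists_component_eq (a : ∀ v : Place K, v.Completionˣ)
    (h : {v : Place K | a v ∉ v.units 0}.Finite) :
    ∃ b : (AdeleRing K)ˣ, ∀ v, component v b = a v := by
  refine ⟨RestrictedProduct.mkUnit a ?_, fun v => Units.ext rfl⟩
  refine Filter.mem_cofinite.2 (h.subset fun v hv hv' => hv ?_)
  obtain ⟨c, -, hc⟩ := hv'
  change a v ∈ (Submonoid.ofClass v.integers).units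
  rw [← hc]
  exact ⟨c.1.2, c⁻¹.1.2⟩

end Ideles

/-! ### Points and places of a complete regular curve -/

section Curves

variable {X : Scheme.{u}} [IsIntegral X]

lemma genericPoint_mem {U : X.Opens} {x : X} (hx : x ∈ U) : genericPoint X ∈ U :=
  ((genericPoint_spec X).specializes trivial).mem_open U.isOpen hx

variable (X) in
omit [IsIntegral X] in
lemma krullDim_eq_topologicalKrullDim : Order.krullDim X = topologicalKrullDim X :=
  letI := specializationOrder X
  (Order.krullDim_eq_of_orderIso (irreducibleSetEquivPoints (α := X))).symm

lemma isClosed_singleton_of_ne_genericPoint (hdim : topologicalKrullDim X = 1) {x : X}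
    (hx : x ≠ genericPoint X) : IsClosed ({x} : Set X) := by
  let _ : PartialOrder X := specializationOrder X
  have h := (Order.krullDim_le_one_iff_forall_isMin (α := X)).1
    ((krullDim_eq_topologicalKrullDim X).trans hdim).le x hx
  refine isClosed_of_closure_subset fun y hy => ?_
  have h1 : x ⤳ y := specializes_iff_mem_closure.2 hy
  exact Set.mem_singleton_iff.2 (Specializes.antisymm (h (show y ≤ x from h1)) h1).eq

lemma ne_genericPoint_of_isClosed (hdim : topologicalKrullDim X = 1) {x : X}
    (hx : IsClosed ({x} : Set X)) : x ≠ genericPoint X := by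
  rintro rfl
  have hu := (genericPoint_spec X).def
  rw [hx.closure_eq] at hu
  have hs : Subsingleton X := ⟨fun a b => by
    have (c : X) : c = genericPoint X := (hu.symm ▸ Set.mem_univ c : c ∈ ({genericPoint X} : Set X))
    rw [this a, this b]⟩
  have : topologicalKrullDim X ≤ 0 := by
    rw [← krullDim_eq_topologicalKrullDim]
    exact Order.krullDim_nonpos_of_subsingleton
  rw [hdim] at this
  exact absurd this (by decide)

lemma finite_compl_of_mem [NoetherianSpace X] (hdim : topologicalKrullDim X = 1) {U : X.Opens}
    (hU : genericPoint X ∈ U) : ((U : Set X)ᶜ).Finite := by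
  obtain ⟨S, hS, hc, hi, h⟩ :=
    NoetherianSpace.exists_finite_set_isClosed_irreducible (isClosed_compl_iff.2 U.isOpen)
  rw [h]
  refine hS.sUnion fun t ht => ?_
  obtain ⟨z, hz⟩ := QuasiSober.sober (hi t ht) (hc t ht)
  have hzU : z ∈ (U : Set X)ᶜ := h ▸ Set.mem_sUnion_of_mem hz.mem ht
  have := isClosed_singleton_of_ne_genericPoint hdim (x := z) fun h => hzU (h ▸ hU)
  rw [← hz.def, this.closure_eq]
  exact Set.finite_singleton z

lemma isDiscreteValuationRing_stalk (hdim : topologicalKrullDim X = 1) {x : X}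
    (hx : IsClosed ({x} : Set X)) [hreg : IsRegularLocalRing (X.presheaf.stalk x)] :
    IsDiscreteValuationRing (X.presheaf.stalk x) := by
  have hd : ringKrullDim (X.presheaf.stalk x) = 1 := by
    rw [ringKrullDim_stalk_eq_coheight]
    refine le_antisymm ?_ ?_
    · rw [← hdim, ← krullDim_eq_topologicalKrullDim]
      exact Order.coheight_le_krullDim x
    · have : Order.coheight x ≠ 0 := by
        rw [Order.coheight_ne_zero]
        intro h
        refine ne_genericPoint_of_isClosed hdim hx ?_
        have h1 : genericPoint X ⤳ x := genericPoint_specializes x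
        exact (Specializes.antisymm (h (show x ≤ genericPoint X from h1)) h1).eq
      exact_mod_cast Order.one_le_iff_ne_zero.2 this
  have hf : ¬ IsField (X.presheaf.stalk x) := fun h => by
    rw [ringKrullDim_eq_zero_of_isField h] at hd
    exact absurd hd (by decide)
  have := (IsRegularLocalRing.iff_finrank_cotangentSpace _).1 hreg
  rw [hd] at this
  exact ((IsDiscreteValuationRing.TFAE _ hf).out 0 5).2 (by exact_mod_cast this)

lemma algebraMap_germ (x : X) {U : X.Opens} (hx : x ∈ U) (f : Γ(X, U)) :
    algebraMap (X.presheaf.stalk x) X.functionField (X.presheaf.germ U x hx f) =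
      X.presheaf.germ U (genericPoint X) (genericPoint_mem hx) f := by
  have : Nonempty U := ⟨⟨x, hx⟩⟩
  exact X.algebraMap_germ_eq_germToFunctionField hx f

lemma algebraMap_stalk_genericPoint (f : X.presheaf.stalk (genericPoint X)) :
    @algebraMap _ X.functionField _ _ (stalkFunctionFieldAlgebra X (genericPoint X)) f = f := by
  change (X.presheaf.stalkSpecializes (specializes_refl (genericPoint X))).hom f = f
  rw [TopCat.Presheaf.stalkSpecializes_refl]
  rfl

lemma exists_isPlaceOf (x : ClosedPoint X) [IsDiscreteValuationRing (X.presheaf.stalk x.1)] :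
    ∃ v : Place X.functionField, IsPlaceOf v x := by
  refine ⟨⟨{ (algebraMap (X.presheaf.stalk x.1) X.functionField).range with
      mem_or_inv_mem' := fun f => ?_ }, fun h => ?_⟩, fun f => Iff.rfl⟩
  · rcases ValuationRing.isInteger_or_isInteger (X.presheaf.stalk x.1) f with ⟨c, hc⟩ | ⟨c, hc⟩
    · exact Or.inl ⟨c, hc⟩
    · exact Or.inr ⟨c, hc⟩
  · refine IsDiscreteValuationRing.not_isField (X.presheaf.stalk x.1) ?_
    refine MulEquiv.isField (Field.toIsField X.functionField)
      (RingEquiv.ofBijective (algebraMap (X.presheaf.stalk x.1) X.functionField)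
        ⟨IsFractionRing.injective _ _, fun f => ?_⟩).toMulEquiv
    have : f ∈ (⊤ : ValuationSubring X.functionField) := ValuationSubring.mem_top f
    rw [← h] at this
    exact this

variable {k : Type u} [Field k] [Finite k] (π : X ⟶ Spec (CommRingCat.of k))

/-- The elements of a finite field are roots of unity or zero, hence contained in every valuation
ring. -/
lemma mem_valuationSubring_of_finite {K : Type u} [Field K] (g : k →+* K) (A : ValuationSubring K)
    (c : k) : g c ∈ A := by
  rcases eq_or_ne c 0 with rfl | hc
  · simp
  · rw [← ValuationSubring.valuation_le_one_iff]
    have h := pow_card_eq_one' (x := Units.mk0 c hc)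
    have h1 : c ^ Nat.card kˣ = 1 := congrArg Units.val h
    have h2 : A.valuation (g c) ^ Nat.card kˣ = 1 := by
      rw [← map_pow, ← map_pow, h1, map_one, map_one]
    exact ((pow_eq_one_iff_of_nonneg zero_le Nat.card_pos.ne').1 h2).le

/-- The square of the valuative criterion for the generic point of `X` and a place of its function
field. -/
def valuativeCommSq (v : Place X.functionField) : ValuativeCommSq π where
  R := v.1
  K := X.functionField
  i₁ := X.fromSpecStalk (genericPoint X)
  i₂ := Spec.map (CommRingCat.ofHom
    ((Spec.preimage (X.fromSpecStalk (genericPoint X) ≫ π)).hom.codRestrict v.1.toSubring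
      fun c => mem_valuationSubring_of_finite
        (Spec.preimage (X.fromSpecStalk (genericPoint X) ≫ π)).hom v.1 c))
  commSq := ⟨by
    rw [← Spec.map_comp, ← CommRingCat.ofHom_comp]
    conv_lhs => rw [← Spec.map_preimage (X.fromSpecStalk (genericPoint X) ≫ π)]
    rfl⟩

/-- Every morphism `Spec 𝒪_v ⟶ X` extending `Spec K ⟶ X` is a lift in the square of the valuative
criterion. -/
lemma comp_eq_valuativeCommSq (v : Place X.functionField) (l : Spec (.of v.1) ⟶ X)
    (hl : Spec.map (CommRingCat.ofHom (algebraMap v.1 X.functionField)) ≫ l =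
      X.fromSpecStalk (genericPoint X)) : l ≫ π = (valuativeCommSq π v).i₂ := by
  have h := (valuativeCommSq π v).commSq.w
  change X.fromSpecStalk (genericPoint X) ≫ π =
    Spec.map (CommRingCat.ofHom (algebraMap v.1 X.functionField)) ≫ _ at h
  rw [← hl, Category.assoc] at h
  obtain ⟨g, hg⟩ := Spec.map_surjective (l ≫ π)
  obtain ⟨g', hg'⟩ := Spec.map_surjective (valuativeCommSq π v).i₂
  rw [← hg, ← hg'] at h
  have h' : g ≫ CommRingCat.ofHom (algebraMap v.1 X.functionField) =
      g' ≫ CommRingCat.ofHom (algebraMap v.1 X.functionField) :=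
    Spec.map_injective (((Spec.map_comp _ _).trans h).trans (Spec.map_comp _ _).symm)
  rw [← hg, ← hg']
  congr 1
  ext c
  exact congrArg (fun f => f.hom c) h'

lemma algebraMap_stalkClosedPointTo (v : Place X.functionField)
    (l : Spec (.of v.1) ⟶ X)
    (hl : Spec.map (CommRingCat.ofHom (algebraMap v.1 X.functionField)) ≫ l =
      X.fromSpecStalk (genericPoint X)) (c) :
    algebraMap v.1 X.functionField ((Scheme.stalkClosedPointTo l).hom c) =
      algebraMap (X.presheaf.stalk (l (IsLocalRing.closedPoint v.1))) X.functionField c := by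
  have h : Spec.map (CommRingCat.ofHom (algebraMap v.1 X.functionField)) ≫
      Spec.map (Scheme.stalkClosedPointTo l) ≫ X.fromSpecStalk _ =
      Spec.map (X.presheaf.stalkSpecializes ((genericPoint_spec X).specializes trivial)) ≫
        X.fromSpecStalk (l (IsLocalRing.closedPoint v.1)) := by
    rw [Scheme.SpecMap_stalkSpecializes_fromSpecStalk, Scheme.Spec_stalkClosedPointTo_fromSpecStalk,
      hl]
  rw [← Category.assoc, cancel_mono, ← Spec.map_comp] at h
  exact congrArg (fun f => f.hom c) (Spec.map_injective h)

/-- Every place of the function field is centered at a closed point, by the valuative criterion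
of properness. -/
lemma exists_isPlaceOf_of_place [IsProper π] (hdim : topologicalKrullDim X = 1)
    (hreg : ∀ x : X, IsRegularLocalRing (X.presheaf.stalk x)) (v : Place X.functionField) :
    ∃ x : ClosedPoint X, IsPlaceOf v x := by
  have hp : ValuativeCriterion π := by
    have : IsProper π := inferInstance
    rw [IsProper.eq_valuativeCriterion] at this
    exact this.1.1.1
  obtain ⟨⟨l, hl, -⟩⟩ := (hp.existence (valuativeCommSq π v)).exists_lift
  change Spec (.of v.1) ⟶ X at l
  change Spec.map (CommRingCat.ofHom (algebraMap v.1 X.functionField)) ≫ l =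
      X.fromSpecStalk (genericPoint X) at hl
  have key := algebraMap_stalkClosedPointTo v l hl
  have hloc : IsLocalHom (Scheme.stalkClosedPointTo l).hom := inferInstance
  generalize (Scheme.stalkClosedPointTo l).hom = φ at key hloc
  generalize l (IsLocalRing.closedPoint v.1) = x at φ
  have hx : x ≠ genericPoint X := by
    rintro rfl
    refine v.2 (top_le_iff.1 fun f _ => ?_)
    rw [← (key f).trans (algebraMap_stalk_genericPoint f)]
    exact (φ f).2
  have hc := isClosed_singleton_of_ne_genericPoint hdim hx
  have := hreg x
  have := isDiscreteValuationRing_stalk hdim hc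
  refine ⟨⟨x, hc⟩, fun f => ⟨fun hf => ?_, ?_⟩⟩
  · rcases ValuationRing.isInteger_or_isInteger (X.presheaf.stalk x) f with ⟨c, hc⟩ | ⟨c, hc⟩
    · exact ⟨c, hc⟩
    · rcases eq_or_ne f 0 with rfl | hf0
      · exact zero_mem _
      have hu : IsUnit (φ c) := by
        refine IsUnit.of_mul_eq_one ⟨f, hf⟩ (Subtype.ext ?_)
        have := key c
        rw [hc] at this
        change algebraMap v.1 X.functionField (φ c) * f = 1
        rw [this, inv_mul_cancel₀ hf0]
      obtain ⟨d, rfl⟩ := hloc.map_nonunit c hu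
      refine ⟨↑d⁻¹, ?_⟩
      rw [← inv_inv f, ← hc, eq_comm, inv_eq_of_mul_eq_one_right]
      rw [← map_mul, Units.mul_inv, map_one]
  · rintro ⟨c, rfl⟩
    rw [← key]
    exact (φ c).2

/-- A place of the function field has only one center, by the valuative criterion of
separatedness. -/
lemma IsPlaceOf.unique [IsSeparated π] {v : Place X.functionField} {x y : ClosedPoint X}
    (hx : IsPlaceOf v x) (hy : IsPlaceOf v y) : x = y := by
  have key (z : ClosedPoint X) (hz : IsPlaceOf v z) : ∃ l : Spec (.of v.1) ⟶ X,
      Spec.map (CommRingCat.ofHom (algebraMap v.1 X.functionField)) ≫ l =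
        X.fromSpecStalk (genericPoint X) ∧ l (IsLocalRing.closedPoint v.1) = z.1 := by
    let ψ : X.presheaf.stalk z.1 →+* v.1 :=
      (algebraMap (X.presheaf.stalk z.1) X.functionField).codRestrict v.1.toSubring
        fun c => (hz _).2 ⟨c, rfl⟩
    have hψ : IsLocalHom ψ := ⟨fun c hc => by
      obtain ⟨d, hd⟩ := hc.exists_right_inv
      obtain ⟨e, he⟩ := (hz _).1 d.2
      refine IsUnit.of_mul_eq_one e (IsFractionRing.injective _ X.functionField ?_)
      rw [map_mul, map_one, he]
      exact congrArg Subtype.val hd⟩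
    refine ⟨Spec.map (CommRingCat.ofHom ψ) ≫ X.fromSpecStalk z.1, ?_, ?_⟩
    · rw [← Category.assoc, ← Spec.map_comp]
      exact Scheme.SpecMap_stalkSpecializes_fromSpecStalk
        ((genericPoint_spec X).specializes trivial)
    · have : Spec.map (CommRingCat.ofHom ψ) (IsLocalRing.closedPoint v.1) =
        IsLocalRing.closedPoint (X.presheaf.stalk z.1) := IsLocalRing.comap_closedPoint ψ
      refine (congrArg (X.fromSpecStalk z.1) this).trans ?_
      exact Scheme.fromSpecStalk_closedPoint
  obtain ⟨l, hl, hlx⟩ := key x hx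
  obtain ⟨l', hl', hly⟩ := key y hy
  have := (IsSeparated.valuativeCriterion π) (valuativeCommSq π v)
  have := congrArg CommSq.LiftStruct.l (Subsingleton.elim
    (⟨l, hl, comp_eq_valuativeCommSq π v l hl⟩ : (valuativeCommSq π v).commSq.LiftStruct)
    ⟨l', hl', comp_eq_valuativeCommSq π v l' hl'⟩)
  change l = l' at this
  exact Subtype.ext (by rw [← hlx, ← hly, this])

variable (X) in
/-- The properties of a complete regular curve over a finite field on which the comparison of ideles
and line bundles rests: the cofinite topology, local rings that are discrete valuation rings, and
the bijection between closed points and places of the function field. -/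
class IsCompleteRegularCurve : Prop where
  isClosed_iff (x : X) : IsClosed ({x} : Set X) ↔ x ≠ genericPoint X
  nonempty_closedPoint : Nonempty (ClosedPoint X)
  finite_compl (U : X.Opens) (hU : genericPoint X ∈ U) : ((U : Set X)ᶜ).Finite
  isDiscreteValuationRing (x : ClosedPoint X) : IsDiscreteValuationRing (X.presheaf.stalk x.1)
  exists_place (x : ClosedPoint X) : ∃ v : Place X.functionField, IsPlaceOf v x
  exists_center (v : Place X.functionField) : ∃ x : ClosedPoint X, IsPlaceOf v x
  center_unique (v : Place X.functionField) (x y : ClosedPoint X) (hx : IsPlaceOf v x)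
    (hy : IsPlaceOf v y) : x = y

lemma isCompleteRegularCurve [IsProper π] (hdim : topologicalKrullDim X = 1)
    (hreg : ∀ x : X, IsRegularLocalRing (X.presheaf.stalk x)) : IsCompleteRegularCurve X := by
  have := LocallyOfFiniteType.isLocallyNoetherian π
  have : CompactSpace X := QuasiCompact.compactSpace_of_compactSpace π
  have : AlgebraicGeometry.IsNoetherian X := ⟨⟩
  have hd (x : ClosedPoint X) : IsDiscreteValuationRing (X.presheaf.stalk x.1) :=
    have := hreg x.1
    isDiscreteValuationRing_stalk hdim x.2
  refine ⟨fun x => ⟨ne_genericPoint_of_isClosed hdim,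
    isClosed_singleton_of_ne_genericPoint hdim⟩, ?_,
    fun U => finite_compl_of_mem hdim, hd, fun x => ?_,
    exists_isPlaceOf_of_place π hdim hreg, fun v x y => IsPlaceOf.unique π⟩
  · obtain ⟨x, -, hx⟩ := (isClosed_univ (X := X)).exists_closed_singleton Set.univ_nonempty
    exact ⟨⟨x, hx⟩⟩
  · have := hd x
    exact exists_isPlaceOf x

attribute [instance] IsCompleteRegularCurve.isDiscreteValuationRing

variable [IsCompleteRegularCurve X]

/-- The place of a closed point. -/
def place (x : ClosedPoint X) : Place X.functionField :=
  (IsCompleteRegularCurve.exists_place x).choose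

lemma isPlaceOf_place (x : ClosedPoint X) : IsPlaceOf (place x) x :=
  (IsCompleteRegularCurve.exists_place x).choose_spec

lemma isPlaceOf_iff {v : Place X.functionField} {x : ClosedPoint X} :
    IsPlaceOf v x ↔ v = place x := by
  refine ⟨fun h => Subtype.ext (SetLike.ext fun f => (h f).trans (isPlaceOf_place x f).symm), ?_⟩
  rintro rfl
  exact isPlaceOf_place x

variable (X) in
lemma place_bijective : Function.Bijective (place (X := X)) := by
  refine ⟨fun x y h => IsCompleteRegularCurve.center_unique (place x) x y (isPlaceOf_place x)
    (h ▸ isPlaceOf_place y), fun v => ?_⟩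
  obtain ⟨x, hx⟩ := IsCompleteRegularCurve.exists_center v
  exact ⟨x, (isPlaceOf_iff.1 hx).symm⟩

/-- The image of `f ∈ K^×` in `K_x^×`. -/
abbrev toLocal (x : ClosedPoint X) : X.functionFieldˣ →* (place x).Completionˣ :=
  Units.map (toCompletion (place x)).toMonoidHom

lemma forall_place {p : Place X.functionField → Prop} : (∀ v, p v) ↔ ∀ x, p (place x) :=
  (place_bijective X).surjective.forall

lemma mem_congruenceUnits_iff {D : ClosedPoint X →₀ ℕ} {a : (AdeleRing X.functionField)ˣ} :
    a ∈ congruenceUnits D ↔ ∀ x, component (place x) a ∈ (place x).units (D x) := by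
  simp only [congruenceUnits, Subgroup.mem_inf, Subgroup.mem_iInf, Subgroup.mem_comap,
    isPlaceOf_iff]
  constructor
  · rintro ⟨-, h⟩ x
    exact h _ x rfl
  · intro h
    refine ⟨forall_place.2 fun x => units_le_units_zero _ _ (h x), ?_⟩
    rintro _ x rfl
    exact h x

end Curves

/-! ### Sections of line bundles and their germs at the generic point -/

section GenericGerms

variable {X : Scheme.{u}} [IsIntegral X]

/-- The germ of a section at the generic point, which lies in every nonempty open set. -/
def genericGerm (L : X.Modules) {U : X.Opens} {x : X} (hx : x ∈ U) (s : Γ(L, U)) :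
    Stalk L (genericPoint X) :=
  germ L (genericPoint_mem hx) s

lemma genericGerm_res (L : X.Modules) {U V : X.Opens} (h : V ≤ U) {x y : X} (hx : x ∈ V)
    (hy : y ∈ U) (s : Γ(L, U)) : genericGerm L hx (res L h s) = genericGerm L hy s :=
  germ_res L h (genericPoint_mem hx) s

lemma genericGerm_smul (L : X.Modules) {U : X.Opens} {x : X} (hx : x ∈ U) (f : Γ(X, U))
    (s : Γ(L, U)) : genericGerm L hx (f • s) =
      X.presheaf.germ U (genericPoint X) (genericPoint_mem hx) f • genericGerm L hx s :=
  germ_smul L (genericPoint_mem hx) f s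

/-- A relation between the germs of two sections at `x` persists at the generic point. -/
lemma genericGerm_eq_smul {L : X.Modules} {U V : X.Opens} {x : X} (hU : x ∈ U) (hV : x ∈ V)
    {s : Γ(L, U)} {t : Γ(L, V)} {c : X.presheaf.stalk x} (h : germ L hV t = c • germ L hU s) :
    genericGerm L hV t =
      (algebraMap (X.presheaf.stalk x) X.functionField c : X.presheaf.stalk (genericPoint X)) •
        genericGerm L hU s := by
  obtain ⟨A, hA, f, rfl⟩ := TopCat.Presheaf.exists_germ_eq (F := X.presheaf) c
  have hW : x ∈ A ⊓ U := ⟨hA, hU⟩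
  have h1 : germ L hV t = germ L hW
      (X.presheaf.map (homOfLE (inf_le_left : A ⊓ U ≤ A)).op f • res L inf_le_right s) := by
    rw [h, germ_smul, germ_res, TopCat.Presheaf.germ_res_apply]
  obtain ⟨W, hxW, i, j, e⟩ := germ_eq L hV hW h1
  rw [← genericGerm_res L i hxW hV, e, genericGerm_res L j hxW hW, genericGerm_smul,
    genericGerm_res L _ hW hU, TopCat.Presheaf.germ_res_apply, algebraMap_germ]

/-- On an integral scheme, a section of a line bundle is determined by its germ at the generic
point. -/
lemma eq_of_genericGerm_eq {L : X.Modules} (hL : IsLineBundle L) {U : X.Opens} {x : X}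
    (hx : x ∈ U) {s t : Γ(L, U)} (h : genericGerm L hx s = genericGerm L hx t) : s = t := by
  choose W hW r hr using hL
  refine TopCat.Sheaf.eq_of_locally_eq' ⟨_, L.isSheaf⟩ (fun y : U => U ⊓ W y.1) U
    (fun y => homOfLE inf_le_left)
    (fun y hy => Opens.mem_iSup.2 ⟨⟨y, hy⟩, hy, hW y⟩) _ _ fun y => ?_
  change res L inf_le_left s = res L inf_le_left t
  have hy : y.1 ∈ U ⊓ W y.1 := ⟨y.2, hW _⟩
  obtain ⟨f, hf⟩ := (hr y.1 (U ⊓ W y.1) inf_le_right).2 (res L inf_le_left s)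
  obtain ⟨g, hg⟩ := (hr y.1 (U ⊓ W y.1) inf_le_right).2 (res L inf_le_left t)
  replace hf : f • res L (inf_le_right : U ⊓ W y.1 ≤ W y.1) (r y.1) = res L inf_le_left s := hf
  replace hg : g • res L (inf_le_right : U ⊓ W y.1 ≤ W y.1) (r y.1) = res L inf_le_left t := hg
  rw [← hf, ← hg]
  congr 1
  refine germ_injective_of_isIntegral _ _ (genericPoint_mem hy) ?_
  refine ((hr y.1).germ_bijective (genericPoint_mem (hW y.1))).1 ?_
  change _ • genericGerm L (hW y.1) _ = _ • genericGerm L (hW y.1) _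
  rw [← genericGerm_res L (inf_le_right : U ⊓ W y.1 ≤ W y.1) hy (hW y.1), ← genericGerm_smul,
    ← genericGerm_smul, hf, hg, genericGerm_res L _ hy hx, genericGerm_res L _ hy hx, h]

/-- An element of the generic stalk that is locally the germ of a section comes from a section. -/
lemma exists_genericGerm_eq {L : X.Modules} (hL : IsLineBundle L) {U : X.Opens} {x : X}
    (hx : x ∈ U) (m : Stalk L (genericPoint X))
    (h : ∀ y ∈ U, ∃ (W : X.Opens) (hy : y ∈ W) (t : Γ(L, W)), genericGerm L hy t = m) :
    ∃ s : Γ(L, U), genericGerm L hx s = m := by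
  choose W hW t ht using h
  let V (y : U) : X.Opens := U ⊓ W y.1 y.2
  have hV (y : U) : y.1 ∈ V y := ⟨y.2, hW _ _⟩
  let r (y : U) : Γ(L, V y) := res L inf_le_right (t y.1 y.2)
  have hr (y : U) : genericGerm L (hV y) (r y) = m :=
    (genericGerm_res L _ (hV y) (hW y.1 y.2) _).trans (ht _ _)
  obtain ⟨s, hs, -⟩ := TopCat.Sheaf.existsUnique_gluing' ⟨_, L.isSheaf⟩ V U
    (fun y => homOfLE inf_le_left) (fun y hy => Opens.mem_iSup.2 ⟨⟨y, hy⟩, hV _⟩) r fun y z => by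
      have hyz : genericPoint X ∈ V y ⊓ V z := ⟨genericPoint_mem (hV y), genericPoint_mem (hV z)⟩
      refine eq_of_genericGerm_eq hL hyz ?_
      change genericGerm L hyz (res L inf_le_left (r y)) = genericGerm L hyz (res L inf_le_right (r z))
      rw [genericGerm_res L _ hyz (hV y), genericGerm_res L _ hyz (hV z), hr, hr]
  refine ⟨s, ?_⟩
  rw [← hr ⟨x, hx⟩, ← hs ⟨x, hx⟩]
  exact (genericGerm_res L _ (hV ⟨x, hx⟩) hx s).symm

/-- A rational function that is regular at all points of an open set is a regular function on it. -/
lemma exists_germ_eq_of_forall_mem_range {U : X.Opens} {x : X} (hx : x ∈ U) (f : X.functionField)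
    (h : ∀ y ∈ U, f ∈ (algebraMap (X.presheaf.stalk y) X.functionField).range) :
    ∃ g : Γ(X, U), X.presheaf.germ U (genericPoint X) (genericPoint_mem hx) g = f := by
  have h' : ∀ y ∈ U, ∃ (W : X.Opens) (hy : y ∈ W) (t : Γ(X, W)),
      X.presheaf.germ W (genericPoint X) (genericPoint_mem hy) t = f := by
    intro y hy
    obtain ⟨c, hc⟩ := h y hy
    obtain ⟨W, hW, t, rfl⟩ := TopCat.Presheaf.exists_germ_eq (F := X.presheaf) c
    exact ⟨W, hW, t, (algebraMap_germ y hW t).symm.trans hc⟩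
  choose W hW t ht using h'
  let V (y : U) : X.Opens := U ⊓ W y.1 y.2
  have hV (y : U) : y.1 ∈ V y := ⟨y.2, hW _ _⟩
  let r (y : U) : Γ(X, V y) := X.presheaf.map (homOfLE inf_le_right).op (t y.1 y.2)
  have hr (y : U) : X.presheaf.germ (V y) _ (genericPoint_mem (hV y)) (r y) = f :=
    (TopCat.Presheaf.germ_res_apply X.presheaf _ _ (genericPoint_mem (hV y)) _).trans (ht _ _)
  obtain ⟨s, hs, -⟩ := X.sheaf.existsUnique_gluing' V U
    (fun y => homOfLE inf_le_left) (fun y hy => Opens.mem_iSup.2 ⟨⟨y, hy⟩, hV _⟩) r fun y z => by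
      have hyz : genericPoint X ∈ V y ⊓ V z := ⟨genericPoint_mem (hV y), genericPoint_mem (hV z)⟩
      refine germ_injective_of_isIntegral _ _ hyz ?_
      refine (TopCat.Presheaf.germ_res_apply X.presheaf _ _ hyz (r y)).trans
        (Eq.trans ?_ (TopCat.Presheaf.germ_res_apply X.presheaf _ _ hyz (r z)).symm)
      rw [hr, hr]
  refine ⟨s, ?_⟩
  rw [← hr ⟨x, hx⟩, ← hs ⟨x, hx⟩]
  exact (TopCat.Presheaf.germ_res_apply X.presheaf _ _ (genericPoint_mem (hV ⟨x, hx⟩)) s).symm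

end GenericGerms

section Frames

variable {X : Scheme.{u}}

lemma IsFrame.exists_isUnit_smul {L : X.Modules} {U V : X.Opens} {s : Γ(L, U)} {t : Γ(L, V)}
    (hs : IsFrame L s) (ht : IsFrame L t) {x : X} (hU : x ∈ U) (hV : x ∈ V) :
    ∃ c : X.presheaf.stalk x, IsUnit c ∧ germ L hV t = c • germ L hU s := by
  obtain ⟨c, hc⟩ := (hs.germ_bijective hU).2 (germ L hV t)
  obtain ⟨d, hd⟩ := (ht.germ_bijective hV).2 (germ L hU s)
  replace hc : c • germ L hU s = germ L hV t := hc
  replace hd : d • germ L hV t = germ L hU s := hd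
  refine ⟨c, IsUnit.of_mul_eq_one d ((ht.germ_bijective hV).1 ?_), hc.symm⟩
  change (c * d) • germ L hV t = 1 • germ L hV t
  rw [mul_smul, hd, hc, one_smul]

lemma IsFrame.smul_isUnit {L : X.Modules} {U : X.Opens} {s : Γ(L, U)} (hs : IsFrame L s)
    {f : Γ(X, U)} (hf : IsUnit f) : IsFrame L (f • s) := by
  intro V h
  have hu : IsUnit (X.presheaf.map (homOfLE h).op f) := hf.map (X.presheaf.map (homOfLE h).op).hom
  have : (fun g : Γ(X, V) => g • res L h (f • s)) =
      (fun g : Γ(X, V) => g • res L h s) ∘ fun g => g * X.presheaf.map (homOfLE h).op f := by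
    ext g
    simp only [Function.comp_apply, res_smul, mul_smul]
  rw [this]
  exact (hs V h).comp hu.unit.mulRight_bijective

/-- Frames can be multiplied by units of the local ring, after shrinking the neighbourhood. -/
lemma IsFrame.exists_germ_eq_smul {L : X.Modules} {U : X.Opens} {s : Γ(L, U)} (hs : IsFrame L s)
    {x : X} (hx : x ∈ U) {c : X.presheaf.stalk x} (hc : IsUnit c) :
    ∃ (W : X.Opens) (hW : x ∈ W) (t : Γ(L, W)), IsFrame L t ∧ germ L hW t = c • germ L hx s := by
  obtain ⟨V, hV, f, rfl⟩ := TopCat.Presheaf.exists_germ_eq (F := X.presheaf) c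
  have hxf : x ∈ X.basicOpen f := (X.mem_basicOpen f x hV).2 hc
  have hW : x ∈ X.basicOpen f ⊓ U := ⟨hxf, hx⟩
  let g : Γ(X, X.basicOpen f) := X.presheaf.map (homOfLE (X.basicOpen_le f)).op f
  have hg : IsUnit g := RingedSpace.isUnit_res_basicOpen X.toRingedSpace f
  refine ⟨_, hW, X.presheaf.map (homOfLE inf_le_left).op g • res L inf_le_right s,
    (hs.restrict inf_le_right).smul_isUnit (hg.map (X.presheaf.map _).hom), ?_⟩
  rw [germ_smul, germ_res, TopCat.Presheaf.germ_res_apply]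
  congr 1
  exact TopCat.Presheaf.germ_res_apply X.presheaf _ x hxf f

lemma germ_app_eq_smul {L M : X.Modules} (φ : L ⟶ M) {U V : X.Opens} {x : X} (hU : x ∈ U)
    (hV : x ∈ V) {s : Γ(L, U)} {t : Γ(L, V)} {c : X.presheaf.stalk x}
    (h : germ L hV t = c • germ L hU s) :
    germ M hV (φ.app V t) = c • germ M hU (φ.app U s) := by
  obtain ⟨A, hA, f, rfl⟩ := TopCat.Presheaf.exists_germ_eq (F := X.presheaf) c
  have hW : x ∈ A ⊓ U := ⟨hA, hU⟩
  have h1 : germ L hV t = germ L hW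
      (X.presheaf.map (homOfLE (inf_le_left : A ⊓ U ≤ A)).op f • res L inf_le_right s) := by
    rw [h, germ_smul, germ_res, TopCat.Presheaf.germ_res_apply]
  obtain ⟨W, hxW, i, j, e⟩ := germ_eq L hV hW h1
  rw [← germ_res M i hxW, res_app, e, ← res_app, germ_res, Scheme.Modules.Hom.app_smul, germ_smul,
    ← res_app, germ_res, TopCat.Presheaf.germ_res_apply]

variable {D : ClosedPoint X →₀ ℕ}

lemma TrivializedLineBundle.restrict_of_germ_eq_smul (P : TrivializedLineBundle D)
    (x : ClosedPoint X) {U V : X.Opens} (hU : x.1 ∈ U) (hV : x.1 ∈ V) {s : Γ(P.L, U)}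
    {t : Γ(P.L, V)} {c : X.presheaf.stalk x.1} (h : germ P.L hV t = c • germ P.L hU s) :
    P.restrict x hV t = Ideal.Quotient.mk _ c * P.restrict x hU s := by
  simp only [restrict, h, map_smul]
  rfl

lemma exists_isUnit_mk_eq {R : Type*} [CommRing R] [IsLocalRing R] (I : Ideal R) {b : R ⧸ I}
    (hb : IsUnit b) : ∃ c : R, IsUnit c ∧ Ideal.Quotient.mk I c = b := by
  obtain ⟨c, rfl⟩ := Ideal.Quotient.mk_surjective b
  rcases eq_or_ne I ⊤ with rfl | hI
  · exact ⟨1, isUnit_one, Subsingleton.elim _ _⟩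
  · have := Ideal.Quotient.nontrivial_iff.2 hI
    have := IsLocalRing.of_surjective' (Ideal.Quotient.mk I) Ideal.Quotient.mk_surjective
    have := Function.Surjective.isLocalHom (Ideal.Quotient.mk I) Ideal.Quotient.mk_surjective
    exact ⟨c, isUnit_of_map_unit _ _ hb, rfl⟩

/-- Every trivialized line bundle has, near each closed point, a frame that the trivialization
sends to `1`. -/
lemma TrivializedLineBundle.exists_frame_restrict_eq_one (P : TrivializedLineBundle D)
    (x : ClosedPoint X) : ∃ (U : X.Opens) (hx : x.1 ∈ U) (s : Γ(P.L, U)), IsFrame P.L s ∧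
      P.restrict x hx s = 1 := by
  obtain ⟨U, hU, s, hs⟩ := P.isLineBundle x.1
  have hu : IsUnit (P.restrict x hU s) := hs.isUnit_triv hU (P.triv x)
  obtain ⟨b, hb⟩ := hu.exists_left_inv
  obtain ⟨c, hc, rfl⟩ := exists_isUnit_mk_eq _ (IsUnit.of_mul_eq_one _ hb)
  obtain ⟨W, hW, t, ht, h⟩ := hs.exists_germ_eq_smul hU hc
  exact ⟨W, hW, t, ht, (P.restrict_of_germ_eq_smul x hU hW h).trans hb⟩

end Frames

/-! ### The line bundle of an idele -/

section IdeleSheaf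

variable {X : Scheme.{u}} [IsIntegral X]

/-- The `𝒪_X(U)`-module of all functions from the points of `U` to the function field. -/
def RatFun (U : X.Opens) : Type u := U → X.functionField

instance (U : X.Opens) : AddCommGroup (RatFun U) :=
  inferInstanceAs (AddCommGroup (U → X.functionField))

/-- The ring homomorphism that sends a regular function on `U` to the constant map on `U` with
value its germ at the generic point. -/
def toRatFun (U : X.Opens) : Γ(X, U) →+* (U → X.functionField) :=
  RingHom.pi fun y => (X.presheaf.germ U (genericPoint X) (genericPoint_mem y.2)).hom

instance (U : X.Opens) : Module Γ(X, U) (RatFun U) :=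
  Module.compHom (U → X.functionField) (toRatFun U)

lemma RatFun.smul_apply {U : X.Opens} (f : Γ(X, U)) (s : RatFun U) (y : U) :
    (f • s) y = (X.presheaf.germ U (genericPoint X) (genericPoint_mem y.2) f : X.functionField) *
      s y := rfl

variable [IsCompleteRegularCurve X] (a : (AdeleRing X.functionField)ˣ)

/-- The rational function `r` satisfies `a_x r ∈ 𝒪_x`. -/
def IsIntegralAt (x : ClosedPoint X) (r : X.functionField) : Prop :=
  Valued.v ((component (place x) a : (place x).Completion) * toCompletion (place x) r) ≤ 1

variable {a} in
lemma IsIntegralAt.mul {x : ClosedPoint X} {r : X.functionField} (hr : IsIntegralAt a x r)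
    (c : X.presheaf.stalk x.1) : IsIntegralAt a x (algebraMap _ X.functionField c * r) := by
  rw [IsIntegralAt, map_mul (toCompletion (place x)), mul_left_comm, map_mul]
  exact mul_le_one' (valued_algebraMap_le_one (isPlaceOf_place x) c) hr

variable {a} in
lemma IsIntegralAt.mul_inv_mem_range {x : ClosedPoint X} {r : X.functionField}
    (hr : IsIntegralAt a x r) {f : X.functionFieldˣ}
    (hf : component (place x) a * toLocal x f ∈
      (place x).units 0) :
    r * ↑f⁻¹ ∈ (algebraMap (X.presheaf.stalk x.1) X.functionField).range := by
  refine (isPlaceOf_place x _).1 ((valued_toCompletion_le_one_iff _ _).1 ?_)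
  have h : (component (place x) a : (place x).Completion) * toCompletion (place x) r =
      ↑(component (place x) a * toLocal x f) *
        toCompletion (place x) (r * ↑f⁻¹) := by
    change _ = (_ * toCompletion (place x) f) * _
    rw [mul_assoc, ← map_mul, mul_comm (f : X.functionField), mul_assoc, Units.inv_mul, mul_one]
  rw [IsIntegralAt, h, map_mul, (mem_units_zero_iff _).1 hf, one_mul] at hr
  exact hr

/-- The sections over `U` of the line bundle of an idele `a`: the rational functions `r` with
`a_x r ∈ 𝒪_x` for all closed points `x` of `U`. They are encoded as constant maps `U → K`, so that
there is only one section over the empty set. -/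
def ideleSections (U : X.Opens) : Submodule Γ(X, U) (RatFun U) where
  carrier := {s | (∀ y z, s y = s z) ∧ ∀ (x : ClosedPoint X) (hx : x.1 ∈ U),
    IsIntegralAt a x (s ⟨x.1, hx⟩)}
  add_mem' := by
    rintro s t ⟨hs, hs'⟩ ⟨ht, ht'⟩
    refine ⟨fun y z => congrArg₂ (· + ·) (hs y z) (ht y z), fun x hx => ?_⟩
    change IsIntegralAt a x (s ⟨x.1, hx⟩ + t ⟨x.1, hx⟩)
    rw [IsIntegralAt, map_add, mul_add]
    exact Valuation.map_add_le _ (hs' x hx) (ht' x hx)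
  zero_mem' := by
    refine ⟨fun _ _ => rfl, fun x hx => ?_⟩
    change IsIntegralAt a x 0
    simp [IsIntegralAt]
  smul_mem' := by
    rintro f s ⟨hs, hs'⟩
    refine ⟨fun y z => congrArg (_ * ·) (hs y z), fun x hx => ?_⟩
    rw [RatFun.smul_apply, ← algebraMap_germ x.1 hx]
    exact (hs' x hx).mul _

/-- Restriction of sections to a smaller open set. -/
def ideleSectionsRes {U V : X.Opens} (h : V ≤ U) : ideleSections a U →+ ideleSections a V where
  toFun s := ⟨fun y => s.1 ⟨y.1, h y.2⟩, fun _ _ => s.2.1 _ _, fun x hx => s.2.2 x (h hx)⟩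
  map_zero' := rfl
  map_add' _ _ := rfl

/-- The abelian presheaf underlying the line bundle of an idele. -/
def idelePresheaf : TopCat.Presheaf Ab.{u} X where
  obj U := AddCommGrpCat.of (ideleSections a U.unop)
  map i := AddCommGrpCat.ofHom (ideleSectionsRes a i.unop.le)

instance (U : X.Opensᵒᵖ) :
    Module (X.ringCatSheaf.obj.obj U) ((idelePresheaf a).obj U) :=
  inferInstanceAs (Module Γ(X, U.unop) (ideleSections a U.unop))

lemma idelePresheaf_isSheaf : (idelePresheaf a).IsSheaf := by
  rw [TopCat.Presheaf.isSheaf_iff_isSheafUniqueGluing]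
  intro ι U sf h
  let r (i : ι) : ideleSections a (U i) := sf i
  have hc (i j : ι) (y z : X) (hy : y ∈ U i) (hz : z ∈ U j) : (r i).1 ⟨y, hy⟩ = (r j).1 ⟨z, hz⟩ := by
    rw [(r i).2.1 ⟨y, hy⟩ ⟨_, genericPoint_mem hy⟩, (r j).2.1 ⟨z, hz⟩ ⟨_, genericPoint_mem hz⟩]
    have := congrArg (fun t : ideleSections a (U i ⊓ U j) =>
      t.1 ⟨genericPoint X, genericPoint_mem hy, genericPoint_mem hz⟩) (h i j)
    exact this
  choose i hi using fun y : (iSup U : X.Opens) => Opens.mem_iSup.1 y.2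
  let s : ideleSections a (iSup U) := ⟨fun y => (r (i y)).1 ⟨y.1, hi y⟩, fun y z => hc _ _ _ _ _ _,
    fun x hx => (r (i ⟨x.1, hx⟩)).2.2 x _⟩
  refine ⟨s, fun j => Subtype.ext (funext fun y => hc _ _ _ _ _ _), fun t ht => ?_⟩
  refine Subtype.ext (funext fun y => ?_)
  have := congrArg (fun t : ideleSections a (U (i y)) => t.1 ⟨y.1, hi y⟩) (ht (i y))
  exact this

/-- The sheaf of modules of an idele `a`. -/
def ideleSheaf : X.Modules where
  val := PresheafOfModules.ofPresheaf (R := X.ringCatSheaf.obj) (idelePresheaf a) <| by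
    intro U V i f s
    refine Subtype.ext (funext fun y => ?_)
    change (X.presheaf.germ U.unop (genericPoint X) _ f : X.functionField) * _ =
      (X.presheaf.germ V.unop (genericPoint X) _ (X.presheaf.map i f) : X.functionField) * _
    congr 1
    exact (TopCat.Presheaf.germ_res_apply X.presheaf i.unop _ (genericPoint_mem y.2) f).symm
  isSheaf := idelePresheaf_isSheaf a

/-- The value of a section of the line bundle of an idele: a rational function. -/
def value {U : X.Opens} {x : X} (hx : x ∈ U) : Γ(ideleSheaf a, U) →+ X.functionField where
  toFun (s : ideleSections a U) := s.1 ⟨x, hx⟩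
  map_zero' := rfl
  map_add' _ _ := rfl

lemma value_smul {U : X.Opens} {x : X} (hx : x ∈ U) (f : Γ(X, U)) (s : Γ(ideleSheaf a, U)) :
    value a hx (f • s) =
      (X.presheaf.germ U (genericPoint X) (genericPoint_mem hx) f : X.functionField) *
        value a hx s := rfl

lemma value_res {U V : X.Opens} (h : V ≤ U) {x y : X} (hx : x ∈ V) (hy : y ∈ U)
    (s : Γ(ideleSheaf a, U)) : value a hx (res (ideleSheaf a) h s) = value a hy s :=
  (show ideleSections a U from s).2.1 _ _

lemma isIntegralAt_value {U : X.Opens} {y : X} (hy : y ∈ U) (s : Γ(ideleSheaf a, U))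
    (x : ClosedPoint X) (hx : x.1 ∈ U) : IsIntegralAt a x (value a hy s) := by
  have : value a hy s = value a hx s := (show ideleSections a U from s).2.1 _ _
  rw [this]
  exact (show ideleSections a U from s).2.2 x hx

lemma value_injective {U : X.Opens} {x : X} (hx : x ∈ U) :
    Function.Injective (value a hx) := by
  intro s t h
  refine Subtype.ext (funext fun y => ?_)
  exact ((show ideleSections a U from s).2.1 _ _).trans
    (h.trans ((show ideleSections a U from t).2.1 _ _))

lemma exists_value_eq {U : X.Opens} {x : X} (hx : x ∈ U) {r : X.functionField}
    (hr : ∀ x : ClosedPoint X, x.1 ∈ U → IsIntegralAt a x r) :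
    ∃ s : Γ(ideleSheaf a, U), value a hx s = r :=
  ⟨(⟨fun _ => r, fun _ _ => rfl, hr⟩ : ideleSections a U), rfl⟩

lemma section_eq_of_isEmpty {U : X.Opens} (hU : ∀ x, x ∉ U) (s t : Γ(ideleSheaf a, U)) : s = t :=
  Subtype.ext (funext fun y => (hU y.1 y.2).elim)

variable {a}

/-- If `a_x f ∈ 𝒪_x^×` for all closed points `x` of `U`, the section with value `f` is a frame. -/
lemma isFrame_of_value_eq {U : X.Opens} {x : X} (hx : x ∈ U) {s : Γ(ideleSheaf a, U)}
    (f : X.functionFieldˣ) (hs : value a hx s = f)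
    (hf : ∀ x : ClosedPoint X, x.1 ∈ U →
      component (place x) a * toLocal x f ∈
        (place x).units 0) : IsFrame (ideleSheaf a) s := by
  intro V h
  by_cases hV : ∃ y, y ∈ V
  · obtain ⟨y, hy⟩ := hV
    constructor
    · intro g g' e
      refine germ_injective_of_isIntegral _ _ (genericPoint_mem hy) ?_
      have := congrArg (value a hy) e
      simp only [value_smul, value_res a h hy hx, hs] at this
      exact mul_right_cancel₀ f.ne_zero this
    · intro t
      obtain ⟨g, hg⟩ := exists_germ_eq_of_forall_mem_range hy (value a hy t * ↑f⁻¹) fun z hz => by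
        by_cases hzc : IsClosed ({z} : Set X)
        · exact (isIntegralAt_value a hy t ⟨z, hzc⟩ hz).mul_inv_mem_range (hf ⟨z, hzc⟩ (h hz))
        · rw [IsCompleteRegularCurve.isClosed_iff, not_not] at hzc
          subst hzc
          exact ⟨value a hy t * ↑f⁻¹, algebraMap_stalk_genericPoint _⟩
      refine ⟨g, value_injective a hy ?_⟩
      change value a hy (g • res (ideleSheaf a) h s) = _
      rw [value_smul, hg, value_res a h hy hx, hs, mul_assoc, Units.inv_mul, mul_one]
  · push Not at hV
    have : V = ⊥ := by
      ext y
      simpa using hV y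
    subst this
    exact ⟨fun g g' _ => Subsingleton.elim _ _,
      fun t => ⟨0, section_eq_of_isEmpty a hV _ _⟩⟩

/-- A nonzero rational function is a unit at all but finitely many closed points. -/
lemma finite_map_toCompletion_notMem_units (f : X.functionFieldˣ) :
    {x : ClosedPoint X | toLocal x f ∉
      (place x).units 0}.Finite := by
  obtain ⟨U, -, g, hU, hg, hu⟩ := exists_isUnit_germ_eq X (f : X.functionField) f.ne_zero
  obtain ⟨x₀⟩ := hU
  refine ((IsCompleteRegularCurve.finite_compl U (genericPoint_mem x₀.2)).preimage
    (Subtype.val_injective.injOn (s := Set.univ) |>.mono (Set.subset_univ _))).subset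
    fun (x : ClosedPoint X) hx hxU => hx ?_
  change x.1 ∈ U at hxU
  rw [map_toCompletion_mem_units_iff (isPlaceOf_place x)]
  refine ⟨X.presheaf.germ U x.1 hxU g, hu.map (X.presheaf.germ U x.1 hxU).hom, ?_, ?_⟩
  · rw [algebraMap_germ]
    exact hg
  · have : Subsingleton (X.presheaf.stalk x.1 ⧸
        IsLocalRing.maximalIdeal (X.presheaf.stalk x.1) ^ 0) := by
      rw [pow_zero]
      exact Ideal.Quotient.subsingleton_iff.2 Ideal.one_eq_top
    exact Subsingleton.elim _ _

variable (a) in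
/-- Near a closed point `x`, the line bundle of `a` has frames whose value `f ∈ K^×` satisfies
`a_x f ≡ 1` modulo any power of the maximal ideal. -/
lemma exists_isFrame_value (x : ClosedPoint X) (n : ℕ) :
    ∃ (U : X.Opens) (hx : x.1 ∈ U) (s : Γ(ideleSheaf a, U)) (f : X.functionFieldˣ),
      IsFrame (ideleSheaf a) s ∧ value a hx s = f ∧
      component (place x) a * toLocal x f ∈
        (place x).units n := by
  obtain ⟨f, hf⟩ := exists_mul_toCompletion_mem_units (isPlaceOf_place x) n (component (place x) a)
  -- The points other than `x` at which `a` or `f` is not a unit.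
  let B : Set (ClosedPoint X) := ({y | component (place y) a ∉ (place y).units 0} ∪
    {y | toLocal y f ∉ (place y).units 0}) \ {x}
  have hB : B.Finite := (((finite_component_notMem_units a).preimage
    (place_bijective X).injective.injOn).union (finite_map_toCompletion_notMem_units f)).sdiff
  have hBc : IsClosed (Subtype.val '' B) := by
    rw [← Set.biUnion_of_singleton (Subtype.val '' B)]
    refine (hB.image _).isClosed_biUnion ?_
    rintro _ ⟨y, -, rfl⟩
    exact y.2
  let U : X.Opens := ⟨(Subtype.val '' B)ᶜ, hBc.isOpen_compl⟩
  have hx : x.1 ∈ U := by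
    rintro ⟨y, hy, h⟩
    exact hy.2 (Subtype.ext h)
  have hu (y : ClosedPoint X) (hy : y.1 ∈ U) :
      component (place y) a * toLocal y f ∈
        (place y).units 0 := by
    rcases eq_or_ne y x with rfl | hyx
    · exact units_le_units_zero _ _ hf
    · have : y ∉ B := fun h => hy ⟨y, h, rfl⟩
      have h1 : component (place y) a ∈ (place y).units 0 := by
        by_contra h
        exact this ⟨Or.inl h, hyx⟩
      have h2 : toLocal y f ∈ (place y).units 0 := by
        by_contra h
        exact this ⟨Or.inr h, hyx⟩
      exact mul_mem h1 h2
  obtain ⟨s, hs⟩ := exists_value_eq a hx (r := f) fun y hy =>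
    ((mem_units_zero_iff (place y)).1 (hu y hy)).le
  exact ⟨U, hx, s, f, isFrame_of_value_eq hx f hs hu, hs, hf⟩

lemma isLineBundle_ideleSheaf : IsLineBundle (ideleSheaf a) := by
  intro y
  by_cases hy : IsClosed ({y} : Set X)
  · obtain ⟨U, hU, s, -, hs, -⟩ := exists_isFrame_value a ⟨y, hy⟩ 0
    exact ⟨U, hU, s, hs⟩
  · rw [IsCompleteRegularCurve.isClosed_iff, not_not] at hy
    obtain ⟨x⟩ := IsCompleteRegularCurve.nonempty_closedPoint (X := X)
    obtain ⟨U, hU, s, -, hs, -⟩ := exists_isFrame_value a x 0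
    exact ⟨U, hy ▸ genericPoint_mem hU, s, hs⟩

/-- Sections of the line bundle of an idele are compared by comparing their values. -/
lemma germ_eq_smul_of_value_eq {U V : X.Opens} {x : X} (hU : x ∈ U) (hV : x ∈ V)
    {s : Γ(ideleSheaf a, U)} {t : Γ(ideleSheaf a, V)} {c : X.presheaf.stalk x}
    (h : value a hV t =
      @algebraMap _ X.functionField _ _ (stalkFunctionFieldAlgebra X x) c * value a hU s) :
    germ (ideleSheaf a) hV t = c • germ (ideleSheaf a) hU s := by
  obtain ⟨A, hA, g, rfl⟩ := TopCat.Presheaf.exists_germ_eq (F := X.presheaf) c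
  have hW : x ∈ A ⊓ (U ⊓ V) := ⟨hA, hU, hV⟩
  have hWA : A ⊓ (U ⊓ V) ≤ A := inf_le_left
  have hWU : A ⊓ (U ⊓ V) ≤ U := inf_le_right.trans inf_le_left
  have hWV : A ⊓ (U ⊓ V) ≤ V := inf_le_right.trans inf_le_right
  rw [← germ_res _ hWV hW, ← germ_res _ hWU hW,
    ← TopCat.Presheaf.germ_res_apply X.presheaf (homOfLE hWA) x hW, ← germ_smul]
  congr 1
  refine value_injective a hW ?_
  rw [value_smul, value_res a hWV hW hV, value_res a hWU hW hU, h, algebraMap_germ,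
    TopCat.Presheaf.germ_res_apply]

lemma value_eq_of_germ_eq_smul {U V : X.Opens} {x : X} (hU : x ∈ U) (hV : x ∈ V)
    {s : Γ(ideleSheaf a, U)} {t : Γ(ideleSheaf a, V)} {c : X.presheaf.stalk x}
    (h : germ (ideleSheaf a) hV t = c • germ (ideleSheaf a) hU s) :
    value a hV t =
      @algebraMap _ X.functionField _ _ (stalkFunctionFieldAlgebra X x) c * value a hU s := by
  obtain ⟨A, hA, b, rfl⟩ := TopCat.Presheaf.exists_germ_eq (F := X.presheaf) c
  have hW : x ∈ A ⊓ U := ⟨hA, hU⟩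
  have hgerm : germ (ideleSheaf a) hV t = germ (ideleSheaf a) hW
      (X.presheaf.map (homOfLE (inf_le_left : A ⊓ U ≤ A)).op b •
        res (ideleSheaf a) inf_le_right s) := by
    rw [h, germ_smul, germ_res, TopCat.Presheaf.germ_res_apply]
  obtain ⟨W, hxW, i, j, e⟩ := germ_eq _ hV hW hgerm
  have := congrArg (value a hxW) e
  rwa [value_res a i hxW hV, value_res a j hxW hW, value_smul, value_res a _ hW hU,
    TopCat.Presheaf.germ_res_apply, ← algebraMap_germ x hA] at this

end IdeleSheaf

/-! ### Trivialized line bundles represented by ideles -/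

section Representation

variable {X : Scheme.{u}} [IsIntegral X] [IsCompleteRegularCurve X] {D : ClosedPoint X →₀ ℕ}

/-- The idele `a` represents `(L, ψ)`: for some basis `e` of the generic stalk of `L`, every closed
point `x` has a frame `s = f e` of `L` near it with `ψ_x(s) = 1` and `a_x f ∈ 1 + 𝔪_x ^ n_x`. -/
def Represents (a : (AdeleRing X.functionField)ˣ) (P : TrivializedLineBundle D) : Prop :=
  ∃ e : Stalk P.L (genericPoint X),
    (Function.Bijective fun c : X.presheaf.stalk (genericPoint X) => c • e) ∧
    ∀ x : ClosedPoint X, ∃ (U : X.Opens) (hx : x.1 ∈ U) (s : Γ(P.L, U)) (f : X.functionFieldˣ),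
      IsFrame P.L s ∧ P.restrict x hx s = 1 ∧
      genericGerm P.L hx s = (f : X.presheaf.stalk (genericPoint X)) • e ∧
      component (place x) a * toLocal x f ∈ (place x).units (D x)

variable (D) in
lemma exists_triv_ideleSheaf (a : (AdeleRing X.functionField)ˣ) (x : ClosedPoint X) :
    ∃ T : Fiber (ideleSheaf a) D x ≃ₗ[X.presheaf.stalk x.1] StructureFiber D x,
      ∀ (U : X.Opens) (hx : x.1 ∈ U) (s : Γ(ideleSheaf a, U)) (f : X.functionFieldˣ),
        value a hx s = f → component (place x) a * toLocal x f ∈ (place x).units (D x) →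
        T (toFiber (ideleSheaf a) D x (germ (ideleSheaf a) hx s)) = 1 := by
  obtain ⟨V, hV, t, g, ht, hg, hag⟩ := exists_isFrame_value a x (D x)
  refine ⟨(ht.fiberEquiv D x hV).symm, fun U hx s f hs hf => ?_⟩
  have h : toLocal x (f * g⁻¹) ∈ (place x).units (D x) := by
    have := mul_mem hf (inv_mem hag)
    rwa [mul_inv, mul_mul_mul_comm, mul_inv_cancel, one_mul, ← map_inv, ← map_mul] at this
  obtain ⟨c, -, hc, hc1⟩ := (map_toCompletion_mem_units_iff (isPlaceOf_place x)).1 h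
  rw [germ_eq_smul_of_value_eq (a := a) hV hx (s := t) (t := s) (c := c) (by
    rw [hc, hs, hg, ← Units.val_mul, inv_mul_cancel_right]), ← IsFrame.fiberEquiv_mk ht,
    LinearEquiv.symm_apply_apply, hc1]

variable (D) in
/-- The trivialized line bundle of an idele `a`: the trivialization over `D` maps sections at `x`
with value `f` such that `a_x f ∈ 1 + 𝔪_x ^ n_x` to `1`. -/
def ideleBundle (a : (AdeleRing X.functionField)ˣ) : TrivializedLineBundle D where
  L := ideleSheaf a
  isLineBundle := isLineBundle_ideleSheaf
  triv x := (exists_triv_ideleSheaf D a x).choose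

lemma ideleBundle_restrict_eq_one {a : (AdeleRing X.functionField)ˣ} {x : ClosedPoint X}
    {U : X.Opens} (hx : x.1 ∈ U) {s : Γ(ideleSheaf a, U)} {f : X.functionFieldˣ}
    (hs : value a hx s = f) (hf : component (place x) a * toLocal x f ∈ (place x).units (D x)) :
    (ideleBundle D a).restrict x hx s = 1 :=
  (exists_triv_ideleSheaf D a x).choose_spec U hx s f hs hf

lemma mem_units_of_ideleBundle_restrict_eq_one {a : (AdeleRing X.functionField)ˣ}
    {x : ClosedPoint X} {U : X.Opens} (hx : x.1 ∈ U) {s : Γ(ideleSheaf a, U)}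
    (hfr : IsFrame (ideleSheaf a) s) {f : X.functionFieldˣ} (hs : value a hx s = f)
    (h : (ideleBundle D a).restrict x hx s = 1) :
    component (place x) a * toLocal x f ∈ (place x).units (D x) := by
  obtain ⟨V, hV, t, g, htf, hg, hag⟩ := exists_isFrame_value a x (D x)
  have ht := ideleBundle_restrict_eq_one hV hg hag
  obtain ⟨c, hc, hgerm⟩ := htf.exists_isUnit_smul hfr hV hx
  have hc1 := ((ideleBundle D a).restrict_of_germ_eq_smul x hV hx hgerm).symm.trans h
  rw [ht, mul_one] at hc1
  have hval := value_eq_of_germ_eq_smul hV hx hgerm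
  rw [hs, hg] at hval
  have hfg : toLocal x (f * g⁻¹) ∈ (place x).units (D x) := by
    refine (map_toCompletion_mem_units_iff (isPlaceOf_place x)).2 ⟨c, hc, ?_, hc1⟩
    rw [Units.val_mul, hval, mul_assoc, Units.mul_inv, mul_one]
  have := mul_mem hag hfg
  rwa [mul_assoc, ← map_mul, mul_comm f, mul_inv_cancel_left] at this

lemma bijective_smul_units_smul {R M : Type*} [CommRing R] [AddCommGroup M] [Module R M] {e : M}
    (he : Function.Bijective fun c : R => c • e) (u : Rˣ) :
    Function.Bijective fun c : R => c • (u : R) • e := by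
  simpa only [mul_smul, Function.comp_def] using he.comp u.mulRight_bijective

lemma represents_ideleBundle (a : (AdeleRing X.functionField)ˣ) :
    Represents a (ideleBundle D a) := by
  obtain ⟨x₀⟩ := IsCompleteRegularCurve.nonempty_closedPoint (X := X)
  obtain ⟨U₀, h₀, s₀, f₀, hfr, hf₀, -⟩ := exists_isFrame_value a x₀ 0
  refine ⟨(↑f₀⁻¹ : X.presheaf.stalk (genericPoint X)) • genericGerm (ideleSheaf a) h₀ s₀,
    bijective_smul_units_smul (hfr.germ_bijective (genericPoint_mem h₀)) f₀⁻¹, fun x => ?_⟩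
  obtain ⟨U, hx, s, f, hs, hf, haf⟩ := exists_isFrame_value a x (D x)
  refine ⟨U, hx, s, f, hs, ideleBundle_restrict_eq_one hx hf haf, ?_, haf⟩
  refine Eq.trans ?_ (mul_smul (f : X.presheaf.stalk (genericPoint X)) ↑f₀⁻¹ _)
  refine germ_eq_smul_of_value_eq (genericPoint_mem h₀) (genericPoint_mem hx) ?_
  rw [algebraMap_stalk_genericPoint]
  have e1 : value a (genericPoint_mem hx) s = f := hf ▸ (value_res a le_rfl _ hx s)
  have e2 : value a (genericPoint_mem h₀) s₀ = f₀ := hf₀ ▸ (value_res a le_rfl _ h₀ s₀)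
  rw [e1, e2]
  exact (Units.inv_mul_cancel_right _ _).symm

lemma Represents.mul {a b : (AdeleRing X.functionField)ˣ} {P : TrivializedLineBundle D}
    (h : Represents a P) (hb : b ∈ principalIdeles X.functionField ⊔ congruenceUnits D) :
    Represents (a * b) P := by
  obtain ⟨p, ⟨g, hg⟩, n, hn, rfl⟩ := Subgroup.mem_sup.1 hb
  obtain ⟨e, he, h⟩ := h
  rw [mem_congruenceUnits_iff] at hn
  have hp (x : ClosedPoint X) : component (place x) p = toLocal x g :=
    (congrFun hg (place x)).symm
  refine ⟨(g : X.presheaf.stalk (genericPoint X)) • e, bijective_smul_units_smul he g, fun x => ?_⟩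
  obtain ⟨U, hx, s, f, hs, h1, hf, haf⟩ := h x
  refine ⟨U, hx, s, f * g⁻¹, hs, h1, ?_, ?_⟩
  · rw [hf, smul_smul]
    congr 1
    exact (Units.inv_mul_cancel_right _ _).symm
  · have : component (place x) (a * (p * n)) * toLocal x (f * g⁻¹) =
        component (place x) a * toLocal x f * component (place x) n := by
      rw [map_mul, map_mul, map_mul, map_inv, hp, mul_comm (toLocal x f),
        mul_assoc (component (place x) a), mul_mul_mul_comm (toLocal x g), mul_inv_cancel, one_mul,
        mul_comm (component (place x) n), mul_assoc]
    rw [this]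
    exact mul_mem haf (hn x)

/-- Every trivialized line bundle is represented by an idele, with components in `K^×`. -/
lemma exists_represents (P : TrivializedLineBundle D) :
    ∃ a : (AdeleRing X.functionField)ˣ, Represents a P := by
  obtain ⟨U₀, h₀, s₀, hs₀⟩ := P.isLineBundle (genericPoint X)
  have he := hs₀.germ_bijective h₀
  choose U hU s hs h1 using P.exists_frame_restrict_eq_one
  have key (x : ClosedPoint X) : ∃ f : X.functionFieldˣ, genericGerm P.L (hU x) (s x) =
      (f : X.presheaf.stalk (genericPoint X)) • genericGerm P.L h₀ s₀ := by
    obtain ⟨c, hc, h⟩ := hs₀.exists_isUnit_smul (hs x) h₀ (genericPoint_mem (hU x))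
    exact ⟨hc.unit, h⟩
  choose f hf using key
  obtain ⟨c, hc⟩ := (place_bijective X).surjective.hasRightInverse
  have hcp (x : ClosedPoint X) : c (place x) = x := (place_bijective X).injective (hc _)
  -- At the points of `U₀` the frame `s₀` can be compared with `s x`, so that `f x` is a unit there.
  have hunit (x : ClosedPoint X) (hx : x.1 ∈ U₀) : toLocal x (f x) ∈ (place x).units 0 := by
    obtain ⟨d, hd, h⟩ := hs₀.exists_isUnit_smul (hs x) hx (hU x)
    refine (map_toCompletion_mem_units_iff (isPlaceOf_place x)).2 ⟨d, hd, ?_, ?_⟩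
    · have := genericGerm_eq_smul hx (hU x) h
      exact he.1 (this.symm.trans (hf x))
    · rw [← map_one (Ideal.Quotient.mk _), Ideal.Quotient.eq, pow_zero, Ideal.one_eq_top]
      exact Submodule.mem_top
  let b (v : Place X.functionField) : v.Completionˣ :=
    (Units.map (toCompletion v).toMonoidHom (f (c v)))⁻¹
  have hb (x : ClosedPoint X) : b (place x) = (toLocal x (f x))⁻¹ := by
    simp only [b, hcp]
  obtain ⟨a, ha⟩ := exists_component_eq b <| by
    refine (((IsCompleteRegularCurve.finite_compl U₀ h₀).preimage
      Subtype.val_injective.injOn).image place).subset fun v hv => ?_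
    obtain ⟨x, rfl⟩ := (place_bijective X).surjective v
    refine ⟨x, fun hx => hv ?_, rfl⟩
    rw [hb]
    exact inv_mem (hunit x hx)
  refine ⟨a, genericGerm P.L h₀ s₀, he, fun x => ⟨U x, hU x, s x, f x, hs x, h1 x, hf x, ?_⟩⟩
  rw [ha, hb, inv_mul_cancel]
  exact one_mem _

lemma Represents.tensor {a b : (AdeleRing X.functionField)ˣ} {P Q : TrivializedLineBundle D}
    (hP : Represents a P) (hQ : Represents b Q) : Represents (a * b) (P.tensor Q) := by
  obtain ⟨e, he, hP⟩ := hP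
  obtain ⟨e', he', hQ⟩ := hQ
  obtain ⟨U₀, h₀, s₀, t₀, hs₀, ht₀⟩ := exists_frames P.isLineBundle Q.isLineBundle (genericPoint X)
  have key {L : X.Modules} {s₀ : Γ(L, U₀)} (hs₀ : IsFrame L s₀) {e : Stalk L (genericPoint X)}
      (he : Function.Bijective fun c : X.presheaf.stalk (genericPoint X) => c • e) :
      ∃ u : (X.presheaf.stalk (genericPoint X))ˣ,
        e = (u : X.presheaf.stalk (genericPoint X)) • germ L h₀ s₀ := by
    obtain ⟨c, hc⟩ := (hs₀.germ_bijective h₀).2 e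
    obtain ⟨d, hd⟩ := he.2 (germ L h₀ s₀)
    replace hc : c • germ L h₀ s₀ = e := hc
    replace hd : d • e = germ L h₀ s₀ := hd
    refine ⟨⟨c, d, he.1 ?_, he.1 ?_⟩, hc.symm⟩
    · change (c * d) • e = 1 • e
      rw [mul_smul, hd, hc, one_smul]
    · change (d * c) • e = 1 • e
      rw [mul_comm, mul_smul, hd, hc, one_smul]
  obtain ⟨u, rfl⟩ := key hs₀ he
  obtain ⟨w, rfl⟩ := key ht₀ he'
  refine ⟨((u * w : (X.presheaf.stalk (genericPoint X))ˣ) : X.presheaf.stalk (genericPoint X)) •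
    germ (GenPic.tensor P.L Q.L) h₀ (tmul s₀ t₀),
    bijective_smul_units_smul ((hs₀.tensor ht₀).germ_bijective h₀) _, fun x => ?_⟩
  obtain ⟨U, hU, s, f, hs, h1, hf, haf⟩ := hP x
  obtain ⟨V, hV, t, g, ht, h1', hg, hbg⟩ := hQ x
  have hx : x.1 ∈ U ⊓ V := ⟨hU, hV⟩
  refine ⟨U ⊓ V, hx, tmul (res P.L inf_le_left s) (res Q.L inf_le_right t), f * g,
    (hs.restrict _).tensor (ht.restrict _), ?_, ?_, ?_⟩
  · rw [TrivializedLineBundle.restrict_tmul, TrivializedLineBundle.restrict_res,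
      TrivializedLineBundle.restrict_res, h1, h1', one_mul]
  · refine (germ_tmul (genericPoint_mem hx) h₀ (s := s₀) (t := t₀)
      (a := (f : X.presheaf.stalk (genericPoint X)) * u)
      (b := (g : X.presheaf.stalk (genericPoint X)) * w) ?_ ?_).trans ?_
    · rw [mul_smul, ← hf]
      exact genericGerm_res _ _ hx hU s
    · rw [mul_smul, ← hg]
      exact genericGerm_res _ _ hx hV t
    · refine Eq.trans ?_ (mul_smul ((f * g : X.functionFieldˣ) : X.presheaf.stalk (genericPoint X))
        ((u * w : (X.presheaf.stalk (genericPoint X))ˣ) : X.presheaf.stalk (genericPoint X)) _)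
      congr 1
      exact mul_mul_mul_comm _ _ _ _
  · rw [map_mul, map_mul, mul_mul_mul_comm]
    exact mul_mem haf hbg

end Representation

/-! ### Comparison of trivialized line bundles with idele classes -/

section Comparison

/-- A morphism of sheaves of modules that is bijective on sections is an isomorphism. -/
lemma exists_iso_of_bijective {X : Scheme.{u}} {L M : X.Modules} (φ : L ⟶ M)
    (h : ∀ U, Function.Bijective (φ.app U)) : ∃ θ : L ≅ M, θ.hom = φ := by
  have : IsIso φ := Scheme.Modules.Hom.isIso_iff_isIso_app.2 fun U =>
    (ConcreteCategory.isIso_iff_bijective _).2 (h U)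
  exact ⟨asIso φ, rfl⟩

/-- Isomorphisms map frames to frames. -/
lemma IsFrame.map_iso {X : Scheme.{u}} {L M : X.Modules} (θ : L ≅ M) {U : X.Opens} {s : Γ(L, U)}
    (hs : IsFrame L s) : IsFrame M (θ.hom.app U s) := by
  intro V h
  have hb : Function.Bijective (θ.hom.app V) :=
    (ConcreteCategory.isIso_iff_bijective _).1 inferInstance
  have := hb.comp (hs V h)
  convert this using 1
  ext f
  rw [res_app]
  exact (Scheme.Modules.Hom.app_smul θ.hom f _).symm

variable {X : Scheme.{u}} [IsIntegral X] [IsCompleteRegularCurve X] {D : ClosedPoint X →₀ ℕ}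

/-- A line bundle represented by `a`, with generic basis `e`, is mapped to the line bundle of `a` by
taking the coordinates of sections with respect to `e`. -/
lemma exists_hom_ideleSheaf {a : (AdeleRing X.functionField)ˣ} {P : TrivializedLineBundle D}
    {e : Stalk P.L (genericPoint X)}
    (he : Function.Bijective fun c : X.presheaf.stalk (genericPoint X) => c • e)
    (h : ∀ x : ClosedPoint X, ∃ (U : X.Opens) (hx : x.1 ∈ U) (s : Γ(P.L, U))
      (f : X.functionFieldˣ), IsFrame P.L s ∧ P.restrict x hx s = 1 ∧
      genericGerm P.L hx s = (f : X.presheaf.stalk (genericPoint X)) • e ∧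
      component (place x) a * toLocal x f ∈ (place x).units (D x)) :
    ∃ φ : P.L ⟶ ideleSheaf a, ∀ (U : X.Opens) (x : X) (hx : x ∈ U) (s : Γ(P.L, U)),
      genericGerm P.L hx s = (value a hx (φ.app U s) : X.presheaf.stalk (genericPoint X)) • e := by
  let b : X.presheaf.stalk (genericPoint X) ≃ₗ[X.presheaf.stalk (genericPoint X)]
      Stalk P.L (genericPoint X) := LinearEquiv.ofBijective
    (LinearMap.toSpanSingleton (X.presheaf.stalk (genericPoint X)) _ e) he
  have hb (m) : m = b.symm m • e := (b.apply_symm_apply m).symm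
  let r (U : X.Opens) : Γ(P.L, U) →+ ideleSections a U :=
    { toFun := fun s => ⟨fun y => b.symm (genericGerm P.L y.2 s), fun _ _ => rfl, fun x hx => by
        obtain ⟨V, hV, t, f, ht, -, hf, haf⟩ := h x
        obtain ⟨c, hc⟩ := (ht.germ_bijective hV).2 (germ P.L hx s)
        have h1 : b.symm (genericGerm P.L hx s) = algebraMap _ X.functionField c * f := by
          rw [genericGerm_eq_smul hV hx hc.symm, hf, map_smul, map_smul]
          have : b.symm e = 1 := (b.symm_apply_eq).2 (one_smul (X.presheaf.stalk (genericPoint X)) e).symm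
          rw [this]
          exact congrArg (fun z : X.functionField =>
            algebraMap (X.presheaf.stalk x.1) X.functionField c * z) (mul_one (f : X.functionField))
        change IsIntegralAt a x (b.symm (genericGerm P.L hx s))
        rw [h1]
        exact IsIntegralAt.mul ((mem_units_zero_iff _).1 (units_le_units_zero _ _ haf)).le c⟩
      map_zero' := Subtype.ext (funext fun y =>
        (congrArg b.symm (map_zero (germ P.L (genericPoint_mem y.2)))).trans (map_zero b.symm))
      map_add' := fun s t => Subtype.ext (funext fun y =>
        (congrArg b.symm (map_add (germ P.L (genericPoint_mem y.2)) s t)).trans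
          (map_add b.symm _ _)) }
  refine ⟨⟨PresheafOfModules.homMk
    { app := fun U => AddCommGrpCat.ofHom (r U.unop)
      naturality := ?_ } ?_⟩, ?_⟩
  · intro U V i
    ext s
    refine Subtype.ext (funext fun y => ?_)
    exact congrArg b.symm (genericGerm_res P.L i.unop.le y.2 (i.unop.le y.2) s)
  · intro U f s
    refine Subtype.ext (funext fun y => ?_)
    exact (congrArg b.symm (genericGerm_smul P.L y.2 f s)).trans (map_smul b.symm _ _)
  · intro U x hx s
    exact hb _

/-- A trivialized line bundle represented by `a` is isomorphic to the one constructed from `a`. -/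
lemma Represents.equivalent {a : (AdeleRing X.functionField)ˣ} {P : TrivializedLineBundle D}
    (hP : Represents a P) : P.Equivalent (ideleBundle D a) := by
  obtain ⟨e, he, h⟩ := hP
  obtain ⟨φ, hφ⟩ := exists_hom_ideleSheaf he h
  obtain ⟨θ, rfl⟩ := exists_iso_of_bijective φ fun U => by
    by_cases hU : ∃ x, x ∈ U
    · obtain ⟨x, hx⟩ := hU
      constructor
      · intro s t hst
        refine eq_of_genericGerm_eq P.isLineBundle hx ?_
        rw [hφ, hφ, hst]
      · intro t
        obtain ⟨s, hs⟩ := exists_genericGerm_eq P.isLineBundle hx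
          ((value a hx t : X.presheaf.stalk (genericPoint X)) • e) fun y hy => by
            by_cases hyc : IsClosed ({y} : Set X)
            · obtain ⟨V, hV, s, f, hs, -, hf, haf⟩ := h ⟨y, hyc⟩
              obtain ⟨c, hc⟩ :=
                (isIntegralAt_value a hx t ⟨y, hyc⟩ hy).mul_inv_mem_range
                  (units_le_units_zero _ _ haf)
              obtain ⟨W, hW, w, hw⟩ := exists_germ_eq P.L (c • germ P.L hV s)
              refine ⟨W, hW, w, (genericGerm_eq_smul hV hW hw).trans ?_⟩
              rw [hf, hc]
              refine (mul_smul _ (f : X.presheaf.stalk (genericPoint X)) e).symm.trans ?_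
              congr 1
              exact Units.inv_mul_cancel_right _ f
            · rw [IsCompleteRegularCurve.isClosed_iff, not_not] at hyc
              subst hyc
              exact exists_germ_eq P.L _
        refine ⟨s, value_injective a hx (he.1 ?_)⟩
        exact (hφ U x hx s).symm.trans hs
    · push Not at hU
      have : U = ⊥ := by
        ext y
        simpa using hU y
      subst this
      have : Subsingleton Γ(P.L, ⊥) := Module.subsingleton Γ(X, ⊥) _
      exact ⟨fun _ _ _ => Subsingleton.elim _ _,
        fun t => ⟨0, section_eq_of_isEmpty a hU _ _⟩⟩
  refine ⟨θ, fun x U hx s => ?_⟩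
  obtain ⟨V, hV, t, f, ht, h1, hf, haf⟩ := h x
  obtain ⟨c, hc⟩ := (ht.germ_bijective hV).2 (germ P.L hx s)
  replace hc : germ P.L hx s = c • germ P.L hV t := hc.symm
  have hv : value a hV (θ.hom.app V t) = f := he.1 ((hφ V x.1 hV t).symm.trans hf)
  have hv' : value a hx (θ.hom.app U s) =
      algebraMap _ X.functionField c * value a hV (θ.hom.app V t) := by
    rw [hv]
    refine he.1 ((hφ U x.1 hx s).symm.trans ((genericGerm_eq_smul hV hx hc).trans ?_))
    rw [hf]
    exact (mul_smul _ (f : X.presheaf.stalk (genericPoint X)) e).symm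
  rw [P.restrict_of_germ_eq_smul x hV hx hc, h1]
  refine ((ideleBundle D a).restrict_of_germ_eq_smul x hV hx
    (germ_eq_smul_of_value_eq hV hx hv')).trans ?_
  rw [ideleBundle_restrict_eq_one hV hv haf]

/-- An isomorphism between the line bundles of two ideles is multiplication by a rational
function. -/
lemma exists_value_app_eq_mul {a b : (AdeleRing X.functionField)ˣ}
    (θ : ideleSheaf a ≅ ideleSheaf b) :
    ∃ g : X.functionFieldˣ, ∀ (U : X.Opens) (x : X) (hx : x ∈ U) (s : Γ(ideleSheaf a, U)),
      value b hx (θ.hom.app U s) = g * value a hx s := by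
  obtain ⟨x₀⟩ := IsCompleteRegularCurve.nonempty_closedPoint (X := X)
  obtain ⟨U₀, h₀, s₀, f₀, -, hf₀, -⟩ := exists_isFrame_value a x₀ 0
  have hg : value b h₀ (θ.hom.app U₀ s₀) ≠ 0 := by
    intro h
    have hinj : Function.Injective (θ.hom.app U₀) :=
      ((ConcreteCategory.isIso_iff_bijective _).1 inferInstance).1
    have h1 : s₀ = 0 := hinj (value_injective b h₀ (by rw [h, map_zero, map_zero]))
    rw [h1, map_zero] at hf₀
    exact f₀.ne_zero hf₀.symm
  refine ⟨Units.mk0 _ hg * f₀⁻¹, fun U x hx s => ?_⟩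
  have hξ₀ := genericPoint_mem h₀
  have hξ := genericPoint_mem hx
  have e0 : value a hξ₀ s₀ = f₀ := hf₀ ▸ value_res a le_rfl hξ₀ h₀ s₀
  have e1 : value a hξ s = value a hx s := value_res a le_rfl hξ hx s
  have e2 : value b hξ (θ.hom.app U s) = value b hx (θ.hom.app U s) :=
    value_res b le_rfl hξ hx _
  have e3 : value b hξ₀ (θ.hom.app U₀ s₀) = value b h₀ (θ.hom.app U₀ s₀) :=
    value_res b le_rfl hξ₀ h₀ _
  -- At the generic point, `s` is a multiple of `s₀`, and `θ` is linear.
  have h1 : germ (ideleSheaf a) hξ s =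
      (value a hx s * ↑f₀⁻¹ : X.functionField) • germ (ideleSheaf a) hξ₀ s₀ := by
    refine germ_eq_smul_of_value_eq hξ₀ hξ ?_
    rw [algebraMap_stalk_genericPoint, e0, e1, mul_assoc, Units.inv_mul, mul_one]
  have h2 := value_eq_of_germ_eq_smul hξ₀ hξ (germ_app_eq_smul θ.hom hξ₀ hξ h1)
  rw [algebraMap_stalk_genericPoint, e2, e3] at h2
  rw [h2, Units.val_mul, Units.val_mk0]
  ring

/-- The kernel of the map from ideles to trivialized line bundles. -/
lemma ideleBundle_equivalent_iff {a b : (AdeleRing X.functionField)ˣ} :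
    (ideleBundle D a).Equivalent (ideleBundle D b) ↔
      a⁻¹ * b ∈ principalIdeles X.functionField ⊔ congruenceUnits D := by
  constructor
  · rintro ⟨θ, h⟩
    obtain ⟨g, hg⟩ := exists_value_app_eq_mul θ
    have key (x : ClosedPoint X) :
        component (place x) (a⁻¹ * b) * toLocal x g ∈ (place x).units (D x) := by
      obtain ⟨U, hx, s, f, hs, hf, haf⟩ := exists_isFrame_value a x (D x)
      have h1 := (h x U hx s).trans (ideleBundle_restrict_eq_one hx hf haf)
      have h2 := mem_units_of_ideleBundle_restrict_eq_one hx (hs.map_iso θ) (f := g * f)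
        ((hg U x.1 hx s).trans (by rw [hf, Units.val_mul])) h1
      have e : component (place x) (a⁻¹ * b) * toLocal x g =
          (component (place x) a * toLocal x f)⁻¹ *
            (component (place x) b * toLocal x (g * f)) := by
        rw [map_mul, map_mul, map_inv, ← mul_assoc (component (place x) b), mul_inv,
          mul_mul_mul_comm, inv_mul_cancel, mul_one, mul_assoc]
      rw [e]
      exact mul_mem (inv_mem haf) h2
    obtain ⟨u, hu⟩ := exists_component_eq
      (fun v => component v (a⁻¹ * b) * Units.map (toCompletion v).toMonoidHom g) <| by
        convert Set.finite_empty
        refine Set.eq_empty_iff_forall_notMem.2 (forall_place.2 fun x hx => hx ?_)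
        exact units_le_units_zero _ _ (key x)
    refine Subgroup.mem_sup.2 ⟨a⁻¹ * b * u⁻¹, ⟨g⁻¹, ?_⟩, u, ?_, inv_mul_cancel_right _ _⟩
    · funext v
      change Units.map (toCompletion v).toMonoidHom g⁻¹ = component v (a⁻¹ * b * u⁻¹)
      rw [map_mul, map_inv _ u, hu, map_inv, mul_inv, mul_inv_cancel_left]
    · rw [mem_congruenceUnits_iff]
      intro x
      rw [hu]
      exact key x
  · intro h
    have := ((represents_ideleBundle (D := D) a).mul h).equivalent
    rwa [mul_inv_cancel_left] at this

variable (D) in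
/-- The bijection between idele classes and classes of trivialized line bundles. -/
def ideleClassEquiv : IdeleClassGroup D ≃ PicD D :=
  Equiv.ofBijective
    (Quotient.lift (fun a => (⟦ideleBundle D a⟧ : PicD D)) fun _ _ h =>
      Quotient.sound (ideleBundle_equivalent_iff.2 (QuotientGroup.leftRel_apply.1 h))) <| by
    constructor
    · rintro ⟨a⟩ ⟨b⟩ h
      exact QuotientGroup.eq.2 (ideleBundle_equivalent_iff.1 (Quotient.exact h))
    · rintro ⟨P⟩
      obtain ⟨a, ha⟩ := exists_represents P
      exact ⟨QuotientGroup.mk a,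
        Quotient.sound ((TrivializedLineBundle.setoid D).iseqv.symm ha.equivalent)⟩

lemma ideleClassEquiv_mul (a b : IdeleClassGroup D) :
    ideleClassEquiv D (a * b) = (ideleClassEquiv D a).tensor (ideleClassEquiv D b) := by
  obtain ⟨a, rfl⟩ := QuotientGroup.mk_surjective a
  obtain ⟨b, rfl⟩ := QuotientGroup.mk_surjective b
  exact Quotient.sound ((TrivializedLineBundle.setoid D).iseqv.symm
    ((represents_ideleBundle a).tensor (represents_ideleBundle b)).equivalent)

end Comparison

end GenPic

end

theorem propositionE {k : Type u} [Field k] [Finite k] {X : Scheme.{u}}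
    (π : X ⟶ Spec (CommRingCat.of k)) [IsIntegral X] [IsProper π]
    (hdim : topologicalKrullDim X = 1)
    (hreg : ∀ x : X, IsRegularLocalRing (X.presheaf.stalk x))
    (D : GenPic.ClosedPoint X →₀ ℕ) :
    ∃ _ : CommGroup (GenPic.PicD D),
      (∀ a b : GenPic.PicD D, a * b = GenPic.PicD.tensor a b) ∧
        Nonempty (GenPic.IdeleClassGroup D ≃* GenPic.PicD D) := by
  have := GenPic.isCompleteRegularCurve π hdim hreg
  let e := GenPic.ideleClassEquiv D
  have key (a b : GenPic.PicD D) : e (e.symm a * e.symm b) = a.tensor b := by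
    rw [GenPic.ideleClassEquiv_mul, e.apply_symm_apply, e.apply_symm_apply]
  refine ⟨e.symm.commGroup, fun a b => key a b, ⟨?_⟩⟩
  letI := e.symm.commGroup
  exact e.symm.mulEquiv.symm
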